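/- **Setting.** Let $n\ge 0$, $V=\mathbb R^{2n}$ with standard basis $a_1,\dots,a_n,b_1,\dots,b_n$ and symplectic form $\omega_0(a_i,b_j)=\delta_{ij}$, $\omega_0(a_i,a_j)=\omega_0(b_i,b_j)=0$; write $h=(h_1,h_2)=\sum_j (h_1)_ja_j+\sum_j (h_2)_jb_j$. Let $\mathfrak h$ be the Siegel space of complex symmetric $n\times n$ matrices with positive definite imaginary part, on which $Sp(2n,\mathbb R)$ acts by $g(T)=(DT-C)(A-BT)^{-1}$, $g=\left(\begin{smallmatrix}A&B\\C&D\end{smallmatrix}\right)$. For $T=X+iY\in\mathfrak h$ let $J_T=\left(\begin{smallmatrix}-Y^{-1}X&-Y^{-1}\\Y+XY^{-1}X&XY^{-1}\end{smallmatrix}\right)$ be the complex structure on $V$ for which $\{v-iJ_Tv: v\in V\}$ is the complex span of the vectors $a_i-\sum_jT_{ij}b_j$. Let $\sigma$ be symplectic Clifford multiplication on $\mathcal S(\mathbb R^n)$, that is the real linear map $V\to \mathrm{End}(\mathcal S(\mathbb R^n))$ with $\sigma(a_j)=ix_j$, $\sigma(b_j)=-\partial/\partial x_j$ (the differential of the Heisenberg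 representation $(\pi((x,y),t)f)(z)=e^{i(t+\langle x,z-y/2\rangle)}f(z-y)$), and put $\sigma_T(v)=\sigma(v)-i\,\sigma(J_Tv)$. For $k=1$ (resp. $k=2$) let $\mathrm{Im}_k(\sigma_T)\subset \mathrm{End}(\mathcal S(\mathbb R^n))$ be the (commutative, unital) real subalgebra generated by the $\sigma_T(a_j)$ (resp. by the $\sigma_T(a_j)$ and $\sigma_T(b_j)$), $1\le j\le n$; it is the image of $\mathcal A_k(V)$ under $\sigma_T$. A subrepresentation is a complex linear subspace of $\mathcal S(\mathbb R^n)$ invariant under the algebra; it is irreducible if it is non-zero and has no invariant complex subspaces except $0$ and itself; two of them are equivalent if there is a complex linear bijection between them commuting with the algebra. Let $f_{0,T}(z)=e^{-\frac i2\langle z,T^{-1}z\rangle}$ and $f_{h,T}=\pi(h,0)f_{0,T}$. Let $\rho:Mp(2n,\mathbb R)\to Sp(2n,\mathbb R)$ be the metaplectic two-fold covering (pairs of $g\in Sp(2n,\mathbb R)$ and a continuous branch of $\det(A-BT)^{1/2}$ on $\mathfrak h$), and let $G=H_n\times_\rho Mp(2n,\mathbb R)$ be the set of triples $(h,t,g)\in\mathbb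 R^{2n}\times\mathbb R\times Mp(2n,\mathbb R)$ with $$(h,t,g)(h',t',g')=\bigl(h'+\rho(g')^{-1}h,\ t+t'+\tfrac12\omega_0(\rho(g')^{-1}h,h'),\ gg'\bigr).$$ Let $G_0=\{h=0\}$ and $G_U=\{\rho(g)\in U(n)\}$ with $U(n)=Sp(2n,\mathbb R)\cap O(2n)$. $G$ acts from the right on pairs $(h_0,T)\in\mathbb R^{2n}\times\mathfrak h$ by $\mu\bigl((h,t,g),(h_0,T)\bigr)=(h+\rho(g)^{-1}h_0,\ \rho(g)^{-1}(T))$. **Statement.** Let $k\in\{1,2\}$. 1. For every fixed $T\in\mathfrak h$ the set of equivalence classes of irreducible subrepresentations of $\mathrm{Im}_k(\sigma_T)$ on $\mathcal S(\mathbb R^n)$ is in bijection with $G/G_0$. Explicitly, $x^{-1}G_0\mapsto[\mathbb C\cdot f_{h,T}]$ for $x\in G$, where $h$ is the first component of $\mu(x,(0,T))$, is a well-defined bijection; in particular each $\mathbb C\cdot f_{h,T}$ is an irreducible subrepresentation. 2. The set of all pairs consisting of a $\sigma_T$, $T\in\mathfrak h$, and an equivalence class of irreducible subrepresentations of $\mathrm{Im}_k(\sigma_T)$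 on $\mathcal S(\mathbb R^n)$ is in bijection with $G/(G_0\cap G_U)$. Explicitly, $x^{-1}(G_0\cap G_U)\mapsto(\sigma_{T'},[\mathbb C\cdot f_{h',T'}])$ for $x\in G$, where $(h',T')=\mu(x,(0,iI))$, is a well-defined bijection. -/

import Mathlib

open scoped Matrix SchwartzMap LineDeriv ComplexOrder

noncomputable section

namespace Oscillator

/-! ### The symplectic vector space, its symplectic group and the Siegel space -/

/-- `V = ℝ²ⁿ`.  A vector is written `(x, y) = ∑ xⱼ aⱼ + ∑ yⱼ bⱼ` in the standard basis
`a₁, …, aₙ, b₁, …, bₙ`; `Sum.inl j` is the coordinate of `aⱼ` and `Sum.inr j` that of `bⱼ`. -/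
abbrev V (n : ℕ) : Type := Fin n ⊕ Fin n → ℝ

/-- The basis vector `aⱼ`. -/
def vecA {n : ℕ} (j : Fin n) : V n := Pi.single (Sum.inl j) 1

/-- The basis vector `bⱼ`. -/
def vecB {n : ℕ} (j : Fin n) : V n := Pi.single (Sum.inr j) 1

/-- The standard symplectic form, `ω₀(aᵢ, bⱼ) = δᵢⱼ`, `ω₀(aᵢ, aⱼ) = ω₀(bᵢ, bⱼ) = 0`. -/
def omega {n : ℕ} (v w : V n) : ℝ :=
  ∑ j, (v (Sum.inl j) * w (Sum.inr j) - v (Sum.inr j) * w (Sum.inl j))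

/-- The symplectic group `Sp(2n, ℝ)`, acting on column vectors. -/
abbrev Sp (n : ℕ) : Type := Matrix.symplecticGroup (Fin n) ℝ

/-- Siegel space: complex symmetric `n × n` matrices with positive definite imaginary part. -/
abbrev Siegel (n : ℕ) : Type :=
  {T : Matrix (Fin n) (Fin n) ℂ // T.IsSymm ∧ (T.map Complex.im).PosDef}

/-- The real matrix `M`, regarded as a complex one. -/
def cx {n : ℕ} (M : Matrix (Fin n) (Fin n) ℝ) : Matrix (Fin n) (Fin n) ℂ :=
  M.map Complex.ofReal

/-- `A - B T` for `g = (A B; C D)`. -/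
def den {n : ℕ} (g : Sp n) (T : Matrix (Fin n) (Fin n) ℂ) : Matrix (Fin n) (Fin n) ℂ :=
  cx g.1.toBlocks₁₁ - cx g.1.toBlocks₁₂ * T

/-- `D T - C` for `g = (A B; C D)`. -/
def num {n : ℕ} (g : Sp n) (T : Matrix (Fin n) (Fin n) ℂ) : Matrix (Fin n) (Fin n) ℂ :=
  cx g.1.toBlocks₂₂ * T - cx g.1.toBlocks₂₁

theorem cx_transpose {n : ℕ} (M : Matrix (Fin n) (Fin n) ℝ) : (cx M)ᵀ = cx Mᵀ := rfl

theorem cx_conjTranspose {n : ℕ} (M : Matrix (Fin n) (Fin n) ℝ) : (cx M)ᴴ = cx Mᵀ := by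
  ext i j; simp [cx, Matrix.conjTranspose_apply]

theorem cx_mul {n : ℕ} (M N : Matrix (Fin n) (Fin n) ℝ) : cx (M * N) = cx M * cx N :=
  Matrix.map_mul (f := Complex.ofRealHom)

theorem cx_add {n : ℕ} (M N : Matrix (Fin n) (Fin n) ℝ) : cx (M + N) = cx M + cx N := by
  ext i j; simp [cx]

theorem cx_sub {n : ℕ} (M N : Matrix (Fin n) (Fin n) ℝ) : cx (M - N) = cx M - cx N := by
  ext i j; simp [cx]

theorem cx_one {n : ℕ} : cx (1 : Matrix (Fin n) (Fin n) ℝ) = 1 := by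
  ext i j; simp [cx, Matrix.one_apply, apply_ite]

theorem cx_zero {n : ℕ} : cx (0 : Matrix (Fin n) (Fin n) ℝ) = 0 := by
  ext i j; simp [cx]

theorem posDef_cx {n : ℕ} {Y : Matrix (Fin n) (Fin n) ℝ} (hY : Y.PosDef) : (cx Y).PosDef := by
  refine Matrix.PosDef.of_dotProduct_mulVec_pos ?_ ?_
  · have h := hY.1
    rw [Matrix.IsHermitian, Matrix.conjTranspose_eq_transpose_of_trivial] at h
    rw [Matrix.IsHermitian, cx_conjTranspose, h]
  · intro u hu
    have hs : ∀ i j, Y i j = Y j i := fun i j => by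
      have := congrFun (congrFun hY.1 j) i
      simpa [Matrix.conjTranspose_apply] using this
    have key : star u ⬝ᵥ (cx Y *ᵥ u) =
        (((fun i => (u i).re) ⬝ᵥ (Y *ᵥ fun i => (u i).re) +
          (fun i => (u i).im) ⬝ᵥ (Y *ᵥ fun i => (u i).im) : ℝ) : ℂ) := by
      have h1 : star u ⬝ᵥ (cx Y *ᵥ u) = ∑ i, ∑ j, star (u i) * ((Y i j : ℂ) * u j) := by
        simp [dotProduct, Matrix.mulVec, Finset.mul_sum, cx]
      have h2 : (∑ i, ∑ j, ((u i).re * (Y i j * (u j).im) - (u i).im * (Y i j * (u j).re))) = 0 := by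
        simp only [Finset.sum_sub_distrib]
        rw [sub_eq_zero, Finset.sum_comm]
        refine Finset.sum_congr rfl fun i _ => Finset.sum_congr rfl fun j _ => ?_
        rw [hs j i]; ring
      rw [h1]
      apply Complex.ext
      · simp [dotProduct, Matrix.mulVec, Finset.mul_sum, ← Finset.sum_add_distrib]
      · rw [Complex.ofReal_im, ← h2, Complex.im_sum]
        refine Finset.sum_congr rfl fun i _ => ?_
        rw [Complex.im_sum]
        refine Finset.sum_congr rfl fun j _ => ?_
        simp
        ring
    rw [key]
    have hne : (fun i => (u i).re) ≠ 0 ∨ (fun i => (u i).im) ≠ 0 := by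
      by_contra! h
      apply hu
      funext i
      exact Complex.ext (congrFun h.1 i) (congrFun h.2 i)
    have p1 := hY.posSemidef.dotProduct_mulVec_nonneg (fun i => (u i).re)
    have p2 := hY.posSemidef.dotProduct_mulVec_nonneg (fun i => (u i).im)
    simp only [star_trivial] at p1 p2
    rw [← Complex.ofReal_zero, Complex.real_lt_real]
    rcases hne with h | h
    · have := hY.dotProduct_mulVec_pos h
      simp only [star_trivial] at this
      linarith
    · have := hY.dotProduct_mulVec_pos h
      simp only [star_trivial] at this
      linarith

theorem posDef_of_cx {n : ℕ} {Y : Matrix (Fin n) (Fin n) ℝ} (hY : (cx Y).PosDef) :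
    Y.PosDef := by
  refine Matrix.PosDef.of_dotProduct_mulVec_pos ?_ ?_
  · have h := hY.1
    ext i j
    have := congrFun (congrFun h i) j
    simpa [cx, Matrix.conjTranspose_apply] using this
  · intro x hx
    have hx' : (fun i => (x i : ℂ)) ≠ 0 := by
      intro h
      apply hx
      funext i
      simpa using congrFun h i
    have := hY.dotProduct_mulVec_pos hx'
    have e : star (fun i => (x i : ℂ)) ⬝ᵥ (cx Y *ᵥ fun i => (x i : ℂ)) =
        ((star x ⬝ᵥ (Y *ᵥ x) : ℝ) : ℂ) := by
      simp [dotProduct, Matrix.mulVec, cx]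
    rw [e, ← Complex.ofReal_zero, Complex.real_lt_real] at this
    exact this

theorem block_rel {n : ℕ} (g : Sp n) (S T : Matrix (Fin n) (Fin n) ℂ) :
    ((cx g.1.toBlocks₁₁)ᵀ - S * (cx g.1.toBlocks₁₂)ᵀ) * num g T -
      (S * (cx g.1.toBlocks₂₂)ᵀ - (cx g.1.toBlocks₂₁)ᵀ) * den g T = T - S := by
  have hg : Matrix.fromBlocks g.1.toBlocks₁₁ g.1.toBlocks₁₂ g.1.toBlocks₂₁ g.1.toBlocks₂₂ ∈
      Matrix.symplecticGroup (Fin n) ℝ := by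
    rw [Matrix.fromBlocks_toBlocks]; exact g.2
  obtain ⟨h1, h2, h3⟩ := SymplecticGroup.fromBlocks_mem_iff.1 hg
  have h4 : g.1.toBlocks₂₂ᵀ * g.1.toBlocks₁₁ - g.1.toBlocks₁₂ᵀ * g.1.toBlocks₂₁ = 1 := by
    have := congrArg Matrix.transpose h3
    simpa using this
  have h1 := congrArg cx h1
  have h2 := congrArg cx h2
  have h3 := congrArg cx h3
  have h4 := congrArg cx h4
  simp only [cx_mul, cx_sub, cx_one] at h1 h2 h3 h4
  simp only [num, den, cx_transpose]
  generalize cx g.1.toBlocks₁₁ = A at *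
  generalize cx g.1.toBlocks₁₂ = B at *
  generalize cx g.1.toBlocks₂₁ = C at *
  generalize cx g.1.toBlocks₂₂ = D at *
  generalize cx g.1.toBlocks₁₁ᵀ = A' at *
  generalize cx g.1.toBlocks₁₂ᵀ = B' at *
  generalize cx g.1.toBlocks₂₁ᵀ = C' at *
  generalize cx g.1.toBlocks₂₂ᵀ = D' at *
  calc (A' - S * B') * (D * T - C) - (S * D' - C') * (A - B * T)
      = (A' * D - C' * B) * T - (A' * C - C' * A) - S * (B' * D - D' * B) * T
        - S * (D' * A - B' * C) := by noncomm_ring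
    _ = T - S := by rw [h1, h2, h3, h4]; simp

theorem den_transpose {n : ℕ} (g : Sp n) (T : Siegel n) :
    (den g T.1)ᵀ = (cx g.1.toBlocks₁₁)ᵀ - T.1 * (cx g.1.toBlocks₁₂)ᵀ := by
  have := T.2.1
  rw [Matrix.IsSymm] at this
  simp [den, this]

theorem num_transpose {n : ℕ} (g : Sp n) (T : Siegel n) :
    (num g T.1)ᵀ = T.1 * (cx g.1.toBlocks₂₂)ᵀ - (cx g.1.toBlocks₂₁)ᵀ := by
  have := T.2.1
  rw [Matrix.IsSymm] at this
  simp [num, this]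

theorem den_conjTranspose {n : ℕ} (g : Sp n) (T : Siegel n) :
    (den g T.1)ᴴ = (cx g.1.toBlocks₁₁)ᵀ - T.1ᴴ * (cx g.1.toBlocks₁₂)ᵀ := by
  simp [den, cx_conjTranspose, cx_transpose]

theorem num_conjTranspose {n : ℕ} (g : Sp n) (T : Siegel n) :
    (num g T.1)ᴴ = T.1ᴴ * (cx g.1.toBlocks₂₂)ᵀ - (cx g.1.toBlocks₂₁)ᵀ := by
  simp [num, cx_conjTranspose, cx_transpose]

theorem sub_conjTranspose_of_symm {n : ℕ} {T : Matrix (Fin n) (Fin n) ℂ} (hT : T.IsSymm) :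
    T - Tᴴ = (2 * Complex.I) • cx (T.map Complex.im) := by
  ext i j
  have h : T j i = T i j := hT.apply i j
  apply Complex.ext <;> simp [cx, Matrix.conjTranspose_apply, h]
  ring

theorem den_isUnit {n : ℕ} (g : Sp n) (T : Siegel n) : IsUnit (den g T.1).det := by
  rw [isUnit_iff_ne_zero]
  intro h0
  obtain ⟨u, hu, hPu⟩ := Matrix.exists_mulVec_eq_zero_iff.2 h0
  have r := block_rel g T.1ᴴ T.1
  rw [← den_conjTranspose, ← num_conjTranspose, sub_conjTranspose_of_symm T.2.1] at r
  have e : star u ⬝ᵥ (((den g T.1)ᴴ * num g T.1 - (num g T.1)ᴴ * den g T.1) *ᵥ u) = 0 := by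
    rw [Matrix.sub_mulVec, dotProduct_sub, ← Matrix.mulVec_mulVec, ← Matrix.mulVec_mulVec, hPu,
      Matrix.mulVec_zero, dotProduct_zero, sub_zero, Matrix.dotProduct_mulVec,
      ← Matrix.star_mulVec, hPu]
    simp
  rw [r, Matrix.smul_mulVec, dotProduct_smul] at e
  have hpos := (posDef_cx T.2.2).dotProduct_mulVec_pos hu
  rcases smul_eq_zero.1 e with h | h
  · simp at h
  · rw [h] at hpos
    exact lt_irrefl _ hpos

theorem num_mul_inv_symm {n : ℕ} (g : Sp n) (T : Siegel n) :
    (num g T.1 * (den g T.1)⁻¹).IsSymm := by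
  have r := block_rel g T.1 T.1
  rw [← den_transpose, ← num_transpose, sub_self, sub_eq_zero] at r
  have hu := den_isUnit g T
  have hu' : IsUnit (den g T.1)ᵀ.det := by rwa [Matrix.det_transpose]
  rw [Matrix.IsSymm, Matrix.transpose_mul, Matrix.transpose_nonsing_inv]
  calc ((den g T.1)ᵀ)⁻¹ * (num g T.1)ᵀ
      = ((den g T.1)ᵀ)⁻¹ * ((num g T.1)ᵀ * den g T.1) * (den g T.1)⁻¹ := by
        rw [Matrix.mul_assoc, Matrix.mul_assoc, Matrix.mul_nonsing_inv _ hu, Matrix.mul_one]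
    _ = num g T.1 * (den g T.1)⁻¹ := by
        rw [← r, ← Matrix.mul_assoc, Matrix.nonsing_inv_mul _ hu', Matrix.one_mul]

theorem num_mul_inv_posDef {n : ℕ} (g : Sp n) (T : Siegel n) :
    ((num g T.1 * (den g T.1)⁻¹).map Complex.im).PosDef := by
  have hu := den_isUnit g T
  have huH : IsUnit (den g T.1)ᴴ.det := by
    rw [Matrix.det_conjTranspose]; exact hu.star
  have r := block_rel g T.1ᴴ T.1
  rw [← den_conjTranspose, ← num_conjTranspose, sub_conjTranspose_of_symm T.2.1] at r
  have s := sub_conjTranspose_of_symm (num_mul_inv_symm g T)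
  have e : num g T.1 * (den g T.1)⁻¹ - (num g T.1 * (den g T.1)⁻¹)ᴴ =
      (2 * Complex.I) • (((den g T.1)⁻¹)ᴴ * cx (T.1.map Complex.im) * (den g T.1)⁻¹) := by
    rw [← Matrix.smul_mul, ← Matrix.mul_smul, ← r, Matrix.mul_sub, Matrix.sub_mul,
      Matrix.conjTranspose_mul, Matrix.conjTranspose_nonsing_inv]
    congr 1
    · rw [← Matrix.mul_assoc, Matrix.nonsing_inv_mul _ huH, Matrix.one_mul]
    · rw [Matrix.mul_assoc, Matrix.mul_assoc, Matrix.mul_nonsing_inv _ hu, Matrix.mul_one]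
  rw [s] at e
  have e' := smul_right_injective _ (by simp : (2 * Complex.I) ≠ 0) e
  apply posDef_of_cx
  rw [e']
  apply (posDef_cx T.2.2).conjTranspose_mul_mul_same
  apply Matrix.mulVec_injective_of_isUnit
  rw [Matrix.isUnit_iff_isUnit_det]
  exact Matrix.isUnit_nonsing_inv_det _ hu

/-- The action of `Sp(2n, ℝ)` on Siegel space: `g(T) = (D T - C)(A - B T)⁻¹` for
`g = (A B; C D)`. -/
def spAct {n : ℕ} (g : Sp n) (T : Siegel n) : Siegel n :=
  ⟨num g T.1 * (den g T.1)⁻¹, num_mul_inv_symm g T, num_mul_inv_posDef g T⟩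

theorem num_eq {n : ℕ} (g : Sp n) (T : Siegel n) : num g T.1 = (spAct g T).1 * den g T.1 := by
  simp only [spAct]
  rw [Matrix.mul_assoc, Matrix.nonsing_inv_mul _ (den_isUnit g T), Matrix.mul_one]

theorem den_num_mul {n : ℕ} (g g' : Sp n) (T : Siegel n) :
    den (g * g') T.1 = den g (spAct g' T).1 * den g' T.1 ∧
    num (g * g') T.1 = num g (spAct g' T).1 * den g' T.1 := by
  have e := num_eq g' T
  have hb : (g * g').1 = Matrix.fromBlocks
      (g.1.toBlocks₁₁ * g'.1.toBlocks₁₁ + g.1.toBlocks₁₂ * g'.1.toBlocks₂₁)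
      (g.1.toBlocks₁₁ * g'.1.toBlocks₁₂ + g.1.toBlocks₁₂ * g'.1.toBlocks₂₂)
      (g.1.toBlocks₂₁ * g'.1.toBlocks₁₁ + g.1.toBlocks₂₂ * g'.1.toBlocks₂₁)
      (g.1.toBlocks₂₁ * g'.1.toBlocks₁₂ + g.1.toBlocks₂₂ * g'.1.toBlocks₂₂) := by
    rw [← Matrix.fromBlocks_multiply, Matrix.fromBlocks_toBlocks, Matrix.fromBlocks_toBlocks]
    rfl
  constructor
  · calc den (g * g') T.1 = cx g.1.toBlocks₁₁ * den g' T.1 - cx g.1.toBlocks₁₂ * num g' T.1 := by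
          simp only [den, num, hb, Matrix.toBlocks_fromBlocks₁₁, Matrix.toBlocks_fromBlocks₁₂,
            cx_add, cx_mul]
          noncomm_ring
      _ = _ := by rw [e, den.eq_def g, Matrix.sub_mul, Matrix.mul_assoc]
  · calc num (g * g') T.1 = cx g.1.toBlocks₂₂ * num g' T.1 - cx g.1.toBlocks₂₁ * den g' T.1 := by
          simp only [den, num, hb, Matrix.toBlocks_fromBlocks₂₁, Matrix.toBlocks_fromBlocks₂₂,
            cx_add, cx_mul]
          noncomm_ring
      _ = _ := by rw [e, num.eq_def g, Matrix.sub_mul, Matrix.mul_assoc]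

theorem spAct_mul {n : ℕ} (g g' : Sp n) (T : Siegel n) :
    spAct (g * g') T = spAct g (spAct g' T) := by
  apply Subtype.ext
  obtain ⟨h1, h2⟩ := den_num_mul g g' T
  have hu := den_isUnit g' T
  change num (g * g') T.1 * (den (g * g') T.1)⁻¹ =
    num g (spAct g' T).1 * (den g (spAct g' T).1)⁻¹
  rw [h1, h2, Matrix.mul_inv_rev, Matrix.mul_assoc, ← Matrix.mul_assoc (den g' T.1),
    Matrix.mul_nonsing_inv _ hu, Matrix.one_mul]

theorem den_one {n : ℕ} (T : Matrix (Fin n) (Fin n) ℂ) : den 1 T = 1 := by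
  have : (1 : Sp n).1 = Matrix.fromBlocks 1 0 0 1 := Matrix.fromBlocks_one.symm
  rw [den, this, Matrix.toBlocks_fromBlocks₁₁, Matrix.toBlocks_fromBlocks₁₂, cx_one, cx_zero]
  simp

theorem num_one {n : ℕ} (T : Matrix (Fin n) (Fin n) ℂ) : num 1 T = T := by
  have : (1 : Sp n).1 = Matrix.fromBlocks 1 0 0 1 := Matrix.fromBlocks_one.symm
  rw [num, this, Matrix.toBlocks_fromBlocks₂₁, Matrix.toBlocks_fromBlocks₂₂, cx_one, cx_zero]
  simp

theorem spAct_one {n : ℕ} (T : Siegel n) : spAct 1 T = T := by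
  apply Subtype.ext
  simp [spAct, den_one, num_one]

theorem continuous_spAct {n : ℕ} (g : Sp n) : Continuous (spAct g : Siegel n → Siegel n) := by
  have hv : Continuous (fun T : Siegel n => T.1) := continuous_subtype_val
  have hd : Continuous (fun T : Siegel n => den g T.1) := by
    unfold den; fun_prop
  have hn : Continuous (fun T : Siegel n => num g T.1) := by
    unfold num; fun_prop
  refine Continuous.subtype_mk ?_ _
  refine hn.mul ?_
  have : (fun T : Siegel n => (den g T.1)⁻¹) =
      fun T : Siegel n => ((den g T.1).det)⁻¹ • (den g T.1).adjugate := by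
    funext T
    rw [Matrix.inv_def, Ring.inverse_eq_inv']
  rw [this]
  exact (hd.matrix_det.inv₀ fun T => (den_isUnit g T).ne_zero).smul hd.matrix_adjugate

/-- The point `i I` of Siegel space. -/
def iI (n : ℕ) : Siegel n :=
  ⟨Complex.I • 1, by simp [Matrix.IsSymm], by
    have : ((Complex.I • (1 : Matrix (Fin n) (Fin n) ℂ)).map Complex.im) = 1 := by
      ext i j
      by_cases h : i = j <;> simp [Matrix.one_apply, h]
    rw [this]
    exact Matrix.PosDef.one⟩

/-! ### The metaplectic group -/

/-- The metaplectic group: the two-fold covering of `Sp(2n, ℝ)` whose elements over `g` are the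
two branches of the function `T ↦ det (A - B T)^{1/2}` on Siegel space, `g = (A B; C D)`.
(A continuous square root of a nowhere vanishing holomorphic function is holomorphic.) -/
@[ext]
structure Mp (n : ℕ) where
  /-- The image in the symplectic group. -/
  base : Sp n
  /-- The branch of the square root. -/
  root : Siegel n → ℂ
  continuous_root : Continuous root
  root_sq : ∀ T : Siegel n, root T ^ 2 = (den base T.1).det

namespace Mp

variable {n : ℕ}

theorem root_ne_zero (g : Mp n) (T : Siegel n) : g.root T ≠ 0 := by
  intro h
  have := g.root_sq T
  rw [h] at this
  exact (den_isUnit g.base T).ne_zero (by simpa using this.symm)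

instance : One (Mp n) := ⟨⟨1, fun _ => 1, continuous_const, fun T => by simp [den_one]⟩⟩

instance : Mul (Mp n) :=
  ⟨fun g g' => ⟨g.base * g'.base, fun T => g.root (spAct g'.base T) * g'.root T,
    (g.continuous_root.comp (continuous_spAct _)).mul g'.continuous_root, fun T => by
      rw [mul_pow, g.root_sq, g'.root_sq, (den_num_mul g.base g'.base T).1, Matrix.det_mul]⟩⟩

instance : Inv (Mp n) :=
  ⟨fun g => ⟨g.base⁻¹, fun T => (g.root (spAct g.base⁻¹ T))⁻¹,
    (g.continuous_root.comp (continuous_spAct _)).inv₀ fun _ => g.root_ne_zero _, fun T => by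
      have h := (den_num_mul g.base g.base⁻¹ T).1
      rw [mul_inv_cancel, den_one] at h
      have h := congrArg Matrix.det h
      rw [Matrix.det_one, Matrix.det_mul] at h
      rw [inv_pow, g.root_sq]
      exact (eq_inv_of_mul_eq_one_right h.symm).symm⟩⟩

@[simp] theorem one_base : (1 : Mp n).base = 1 := rfl
@[simp] theorem mul_base (g g' : Mp n) : (g * g').base = g.base * g'.base := rfl
@[simp] theorem inv_base (g : Mp n) : (g⁻¹).base = g.base⁻¹ := rfl

instance : Group (Mp n) :=
  Group.ofLeftAxioms
    (fun a b c => Mp.ext (mul_assoc _ _ _) (funext fun T => by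
      change a.root (spAct b.base (spAct c.base T)) * b.root (spAct c.base T) * c.root T = _
      change _ = a.root (spAct (b.base * c.base) T) * (b.root (spAct c.base T) * c.root T)
      rw [spAct_mul, mul_assoc]))
    (fun a => Mp.ext (one_mul _) (funext fun T => one_mul _))
    (fun a => Mp.ext (inv_mul_cancel _) (funext fun T => by
      change (a.root (spAct a.base⁻¹ (spAct a.base T)))⁻¹ * a.root T = 1
      rw [← spAct_mul, inv_mul_cancel, spAct_one, inv_mul_cancel₀ (a.root_ne_zero T)]))

end Mp

/-- The covering homomorphism `ρ : Mp(2n, ℝ) → Sp(2n, ℝ)`. -/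
def rho (n : ℕ) : Mp n →* Sp n where
  toFun := Mp.base
  map_one' := rfl
  map_mul' _ _ := rfl

/-! ### The semidirect product of the Heisenberg group with the metaplectic group -/

theorem omega_eq {n : ℕ} (v w : V n) : omega v w = - (v ⬝ᵥ (Matrix.J (Fin n) ℝ *ᵥ w)) := by
  simp [omega, Matrix.J, dotProduct, Matrix.mulVec, Fintype.sum_sum_type, Matrix.one_apply,
    Matrix.fromBlocks, Finset.sum_sub_distrib]
  ring

theorem omega_mulVec {n : ℕ} (g : Sp n) (v w : V n) :
    omega (g.1 *ᵥ v) (g.1 *ᵥ w) = omega v w := by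
  have h := SymplecticGroup.mem_iff'.1 g.2
  rw [omega_eq, omega_eq, Matrix.mulVec_mulVec, Matrix.dotProduct_mulVec, Matrix.vecMul_mulVec,
    ← Matrix.dotProduct_mulVec, ← Matrix.mul_assoc, h]

theorem omega_add_left {n : ℕ} (u v w : V n) : omega (u + v) w = omega u w + omega v w := by
  simp only [omega, ← Finset.sum_add_distrib, Pi.add_apply]
  exact Finset.sum_congr rfl fun _ _ => by ring

theorem omega_add_right {n : ℕ} (u v w : V n) : omega u (v + w) = omega u v + omega u w := by
  simp only [omega, ← Finset.sum_add_distrib, Pi.add_apply]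
  exact Finset.sum_congr rfl fun _ _ => by ring

theorem omega_neg_left {n : ℕ} (v w : V n) : omega (-v) w = -omega v w := by
  simp only [omega, ← Finset.sum_neg_distrib, Pi.neg_apply]
  exact Finset.sum_congr rfl fun _ _ => by ring

theorem omega_self {n : ℕ} (v : V n) : omega v v = 0 := by
  simp only [omega]
  exact Finset.sum_eq_zero fun _ _ => by ring

/-- The set underlying `G = Hₙ ×_ρ Mp(2n, ℝ)`: triples `(h, t, g)` with `(h, t)` in the
Heisenberg group `Hₙ = ℝ²ⁿ × ℝ`. -/
@[ext]
structure G (n : ℕ) where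
  /-- The vector component. -/
  h : V n
  /-- The central component. -/
  t : ℝ
  /-- The metaplectic component. -/
  g : Mp n

namespace G

variable {n : ℕ}

instance : One (G n) := ⟨⟨0, 0, 1⟩⟩

/-- `(h₁, t₁, g₁)(h₂, t₂, g₂) =
(h₂ + ρ(g₂)⁻¹ h₁, t₁ + t₂ + ½ ω₀(ρ(g₂)⁻¹ h₁, h₂), g₁ g₂)`. -/
instance : Mul (G n) :=
  ⟨fun x y => ⟨y.h + (rho n y.g)⁻¹.1 *ᵥ x.h,
    x.t + y.t + (1 / 2) * omega ((rho n y.g)⁻¹.1 *ᵥ x.h) y.h, x.g * y.g⟩⟩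

instance : Inv (G n) := ⟨fun x => ⟨-((rho n x.g).1 *ᵥ x.h), -x.t, x.g⁻¹⟩⟩

theorem mul_h (x y : G n) : (x * y).h = y.h + (rho n y.g)⁻¹.1 *ᵥ x.h := rfl
theorem mul_t (x y : G n) :
    (x * y).t = x.t + y.t + (1 / 2) * omega ((rho n y.g)⁻¹.1 *ᵥ x.h) y.h := rfl
theorem mul_g (x y : G n) : (x * y).g = x.g * y.g := rfl
theorem one_h : (1 : G n).h = 0 := rfl
theorem one_t : (1 : G n).t = 0 := rfl
theorem one_g : (1 : G n).g = 1 := rfl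
theorem inv_h (x : G n) : (x⁻¹).h = -((rho n x.g).1 *ᵥ x.h) := rfl
theorem inv_t (x : G n) : (x⁻¹).t = -x.t := rfl
theorem inv_g (x : G n) : (x⁻¹).g = x.g⁻¹ := rfl

theorem inv_mulVec_mulVec (s : Sp n) (v : V n) : (s⁻¹).1 *ᵥ (s.1 *ᵥ v) = v := by
  rw [Matrix.mulVec_mulVec, ← Submonoid.coe_mul, inv_mul_cancel]
  simp

instance : Group (G n) :=
  Group.ofLeftAxioms
    (fun x y z => by
      have key : (rho n (y.g * z.g))⁻¹.1 *ᵥ x.h =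
          (rho n z.g)⁻¹.1 *ᵥ ((rho n y.g)⁻¹.1 *ᵥ x.h) := by
        rw [map_mul, _root_.mul_inv_rev, Matrix.mulVec_mulVec]; rfl
      apply G.ext
      · simp only [mul_h, mul_g, key, Matrix.mulVec_add]
        rw [add_assoc]
      · simp only [mul_h, mul_t, mul_g, key, Matrix.mulVec_add, omega_add_left, omega_add_right]
        have := omega_mulVec (rho n z.g)⁻¹ ((rho n y.g)⁻¹.1 *ᵥ x.h) y.h
        rw [this]
        ring
      · exact mul_assoc _ _ _)
    (fun x => by
      apply G.ext
      · simp [mul_h, one_h]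
      · simp [mul_t, one_h, one_t, omega]
      · exact one_mul _)
    (fun x => by
      apply G.ext
      · rw [mul_h, inv_h, Matrix.mulVec_neg, inv_mulVec_mulVec, add_neg_cancel]; rfl
      · rw [mul_t, inv_h, inv_t, Matrix.mulVec_neg, inv_mulVec_mulVec, omega_neg_left, omega_self]
        simp [one_t]
      · exact inv_mul_cancel _)

end G

/-- `G₀ = ({0} × ℝ) ×_ρ Mp(2n, ℝ)`. -/
def G₀ (n : ℕ) : Subgroup (G n) where
  carrier := {x | x.h = 0}
  one_mem' := rfl
  mul_mem' {x y} hx hy := by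
    change x.h = 0 at hx
    change y.h = 0 at hy
    change (x * y).h = 0
    rw [G.mul_h, hx, hy]; simp
  inv_mem' {x} hx := by
    change x.h = 0 at hx
    change (x⁻¹).h = 0
    rw [G.inv_h, hx]; simp

/-- `G_U = Hₙ ×_ρ Û(n)`, where `Û(n) = ρ⁻¹(U(n))` and `U(n) = Sp(2n, ℝ) ∩ O(2n)`. -/
def GU (n : ℕ) : Subgroup (G n) where
  carrier := {x | (rho n x.g).1 ∈ Matrix.orthogonalGroup (Fin n ⊕ Fin n) ℝ}
  one_mem' := by
    change (rho n (1 : G n).g).1 ∈ Matrix.orthogonalGroup (Fin n ⊕ Fin n) ℝ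
    rw [G.one_g, map_one]
    exact one_mem _
  mul_mem' {x y} hx hy := by
    change (rho n (x * y).g).1 ∈ Matrix.orthogonalGroup (Fin n ⊕ Fin n) ℝ
    rw [G.mul_g, map_mul]
    exact mul_mem hx hy
  inv_mem' {x} hx := by
    change (rho n x.g).1 ∈ Matrix.orthogonalGroup (Fin n ⊕ Fin n) ℝ at hx
    change (rho n (x⁻¹).g).1 ∈ Matrix.orthogonalGroup (Fin n ⊕ Fin n) ℝ
    rw [G.inv_g, map_inv, SymplecticGroup.coe_inv']
    rw [Matrix.inv_eq_left_inv ((Matrix.mem_orthogonalGroup_iff' _ _).1 hx)]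
    exact Unitary.star_mem hx

/-- The right action `μ` of `G`, `μ(h, t, g) (h₀, T) = (h + ρ(g⁻¹) h₀, T.g)` with
`T.g = ρ(g)⁻¹(T)`.  The parameter `(h₀, T)` stands for the complex line `ℂ · f_{h₀,T}` together
with the algebra attached to `T`. -/
def mu {n : ℕ} (x : G n) (p : V n × Siegel n) : V n × Siegel n :=
  (x.h + (rho n x.g⁻¹).1 *ᵥ p.1, spAct (rho n x.g⁻¹) p.2)

/-! ### Symplectic Clifford multiplication and the operators `σ_T` -/

/-- The Schwartz space `𝒮(ℝⁿ)`. -/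
abbrev Sch (n : ℕ) : Type := 𝓢(EuclideanSpace ℝ (Fin n), ℂ)

/-- Multiplication by the linear function `z ↦ ⟨x, z⟩`. -/
def mulOp {n : ℕ} (x : EuclideanSpace ℝ (Fin n)) : Module.End ℂ (Sch n) :=
  (SchwartzMap.smulLeftCLM ℂ
    (fun z : EuclideanSpace ℝ (Fin n) => ((inner ℝ x z : ℝ) : ℂ))).toLinearMap

/-- The directional derivative `∂_y = ∑ yⱼ ∂/∂xⱼ`. -/
def derivOp {n : ℕ} (y : EuclideanSpace ℝ (Fin n)) : Module.End ℂ (Sch n) :=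
  (LineDeriv.lineDerivOpCLM ℂ (Sch n) y).toLinearMap

theorem hasTemperateGrowth_inner {n : ℕ} (x : EuclideanSpace ℝ (Fin n)) :
    (fun z : EuclideanSpace ℝ (Fin n) => ((inner ℝ x z : ℝ) : ℂ)).HasTemperateGrowth :=
  (Complex.ofRealCLM.comp (innerSL ℝ x)).hasTemperateGrowth

theorem mulOp_apply {n : ℕ} (x z : EuclideanSpace ℝ (Fin n)) (f : Sch n) :
    mulOp x f z = (inner ℝ x z : ℝ) * f z := by
  simp [mulOp, SchwartzMap.smulLeftCLM_apply_apply (hasTemperateGrowth_inner x)]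

theorem derivOp_apply {n : ℕ} (y z : EuclideanSpace ℝ (Fin n)) (f : Sch n) :
    derivOp y f z = fderiv ℝ f z y := by
  simp [derivOp, SchwartzMap.lineDerivOp_apply_eq_fderiv]

/-- The first (`a`-) component of a vector of `V`. -/
def fstV {n : ℕ} (v : V n) : EuclideanSpace ℝ (Fin n) := WithLp.toLp 2 fun j => v (Sum.inl j)

/-- The second (`b`-) component of a vector of `V`. -/
def sndV {n : ℕ} (v : V n) : EuclideanSpace ℝ (Fin n) := WithLp.toLp 2 fun j => v (Sum.inr j)

/-- Symplectic Clifford multiplication `σ = dπ` on `𝒮(ℝⁿ)`: `σ(aⱼ) = i xⱼ`,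
`σ(bⱼ) = -∂/∂xⱼ`, extended linearly. -/
def sigma (n : ℕ) : V n →ₗ[ℝ] Module.End ℂ (Sch n) where
  toFun v := Complex.I • mulOp (fstV v) - derivOp (sndV v)
  map_add' v w := by
    have h1 : fstV (v + w) = fstV v + fstV w := rfl
    have h2 : sndV (v + w) = sndV v + sndV w := rfl
    ext f z
    simp [mulOp_apply, derivOp_apply, h1, h2, inner_add_left]
    ring
  map_smul' c v := by
    have h1 : fstV (c • v) = c • fstV v := rfl
    have h2 : sndV (c • v) = c • sndV v := rfl
    ext f z
    simp [mulOp_apply, derivOp_apply, h1, h2, inner_smul_left]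
    ring

/-- The complex structure `J_T` on `V`: the one for which `{v - i J_T v : v ∈ V}` is the complex
span of the vectors `aᵢ - ∑ⱼ Tᵢⱼ bⱼ`.  For `T = X + iY` it is
`(-Y⁻¹X, -Y⁻¹; Y + X Y⁻¹ X, X Y⁻¹)`. -/
def cplxStr {n : ℕ} (T : Siegel n) : Matrix (Fin n ⊕ Fin n) (Fin n ⊕ Fin n) ℝ :=
  let X : Matrix (Fin n) (Fin n) ℝ := T.1.map Complex.re
  let Y : Matrix (Fin n) (Fin n) ℝ := T.1.map Complex.im
  Matrix.fromBlocks (-(Y⁻¹ * X)) (-Y⁻¹) (Y + X * Y⁻¹ * X) (X * Y⁻¹)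

/-- For every `v`, the vector `v - i J_T v` lies in the complex span of the `aᵢ - ∑ⱼ Tᵢⱼ bⱼ`. -/
theorem cplxStr_spec {n : ℕ} (T : Siegel n) (v : V n) (i : Fin n) :
    (v (Sum.inr i) : ℂ) - Complex.I * (cplxStr T *ᵥ v) (Sum.inr i) =
      -∑ j, T.1 i j * ((v (Sum.inl j) : ℂ) - Complex.I * (cplxStr T *ᵥ v) (Sum.inl j)) := by
  have hY : IsUnit (T.1.map Complex.im).det :=
    (Matrix.isUnit_iff_isUnit_det _).1 T.2.2.isUnit
  obtain ⟨u, w, rfl⟩ : ∃ u w : Fin n → ℝ, v = Sum.elim u w :=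
    ⟨_, _, (Sum.elim_comp_inl_inr v).symm⟩
  set X : Matrix (Fin n) (Fin n) ℝ := T.1.map Complex.re with hX
  set Y : Matrix (Fin n) (Fin n) ℝ := T.1.map Complex.im with hYd
  set p : Fin n → ℝ := (-(Y⁻¹ * X)) *ᵥ u + (-Y⁻¹) *ᵥ w with hp
  set q : Fin n → ℝ := (Y + X * Y⁻¹ * X) *ᵥ u + (X * Y⁻¹) *ᵥ w with hq
  have hJ : cplxStr T *ᵥ Sum.elim u w = Sum.elim p q := Matrix.fromBlocks_mulVec _ _ _ _ _
  have e1 : w = -(X *ᵥ u) - Y *ᵥ p := by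
    rw [hp, Matrix.mulVec_add, Matrix.mulVec_mulVec, Matrix.mulVec_mulVec, Matrix.mul_neg,
      Matrix.mul_neg, ← Matrix.mul_assoc, Matrix.mul_nonsing_inv _ hY]
    simp [Matrix.neg_mulVec]
  have e2 : q = Y *ᵥ u - X *ᵥ p := by
    rw [hp, hq, Matrix.mulVec_add, Matrix.mulVec_mulVec, Matrix.mulVec_mulVec, Matrix.mul_neg,
      Matrix.mul_neg, ← Matrix.mul_assoc, Matrix.add_mulVec]
    simp only [Matrix.neg_mulVec]
    abel
  rw [hJ]
  simp only [Sum.elim_inl, Sum.elim_inr]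
  rw [e2]
  nth_rewrite 1 [e1]
  apply Complex.ext
  · simp [Matrix.mulVec, dotProduct, hX, hYd, Finset.sum_add_distrib]
    try ring
  · simp [Matrix.mulVec, dotProduct, hX, hYd, Finset.sum_add_distrib]
    try ring

/-- `σ_T = σ ∘ α_{J_T}`, where `α_J(v) = v - i J v`, with `σ` extended complex linearly. -/
def sigmaT {n : ℕ} (T : Siegel n) : V n →ₗ[ℝ] Module.End ℂ (Sch n) :=
  sigma n - Complex.I • (sigma n ∘ₗ (cplxStr T).mulVecLin)

/-- The generators of the two algebras: `a₁, …, aₙ` for `𝒜₁` (index `0`) and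
`a₁, …, aₙ, b₁, …, bₙ` for `𝒜₂` (index `1`). -/
def gens (n : ℕ) : Fin 2 → Set (V n) :=
  ![Set.range vecA, Set.range vecA ∪ Set.range vecB]

/-- For `s = σ_T`, the image `Im(σ_T)` of `𝒜₁` (`i = 0`) or `𝒜₂` (`i = 1`) in `End(𝒮(ℝⁿ))`: the
real unital subalgebra generated by the operators `σ_T(aⱼ)`, resp. `σ_T(aⱼ)` and `σ_T(bⱼ)`. -/
def imAlg {n : ℕ} (i : Fin 2) (s : V n →ₗ[ℝ] Module.End ℂ (Sch n)) :
    Subalgebra ℝ (Module.End ℂ (Sch n)) :=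
  Algebra.adjoin ℝ (s '' gens n i)

/-! ### Irreducible subrepresentations -/

/-- `W` is invariant under all operators in `𝒜`. -/
def Invariant {n : ℕ} (𝒜 : Subalgebra ℝ (Module.End ℂ (Sch n))) (W : Submodule ℂ (Sch n)) : Prop :=
  ∀ a ∈ 𝒜, ∀ f ∈ W, a f ∈ W

/-- Irreducible subrepresentations of an algebra of operators on `𝒮(ℝⁿ)`: non-zero invariant
complex subspaces without non-trivial invariant complex subspaces. -/
structure IrrSubrep {n : ℕ} (𝒜 : Subalgebra ℝ (Module.End ℂ (Sch n))) where
  /-- The underlying complex subspace. -/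
  space : Submodule ℂ (Sch n)
  invariant : Invariant 𝒜 space
  ne_bot : space ≠ ⊥
  irreducible : ∀ U : Submodule ℂ (Sch n), U ≤ space → Invariant 𝒜 U → U = ⊥ ∨ U = space

/-- Equivalence of subrepresentations: a complex linear bijection which commutes with all
operators in `𝒜`. -/
def IrrSubrep.Equivalent {n : ℕ} {𝒜 : Subalgebra ℝ (Module.End ℂ (Sch n))}
    (W₁ W₂ : IrrSubrep 𝒜) : Prop :=
  ∃ e : W₁.space ≃ₗ[ℂ] W₂.space, ∀ (a : Module.End ℂ (Sch n)) (ha : a ∈ 𝒜) (f : W₁.space),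
    (e ⟨a f, W₁.invariant a ha f f.2⟩ : Sch n) = a (e f)

instance irrSetoid {n : ℕ} (𝒜 : Subalgebra ℝ (Module.End ℂ (Sch n))) : Setoid (IrrSubrep 𝒜) where
  r := IrrSubrep.Equivalent
  iseqv :=
    { refl := fun W => ⟨LinearEquiv.refl ℂ _, fun _ _ _ => rfl⟩
      symm := by
        rintro W₁ W₂ ⟨e, he⟩
        refine ⟨e.symm, fun a ha f => ?_⟩
        have h := he a ha (e.symm f)
        rw [e.apply_symm_apply] at h
        have h2 : e ⟨a (e.symm f), W₁.invariant a ha _ (e.symm f).2⟩ =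
            ⟨a f, W₂.invariant a ha f f.2⟩ := Subtype.ext h
        rw [← h2, e.symm_apply_apply]
      trans := by
        rintro W₁ W₂ W₃ ⟨e, he⟩ ⟨e', he'⟩
        refine ⟨e.trans e', fun a ha f => ?_⟩
        have h : e ⟨a f, W₁.invariant a ha f f.2⟩ = ⟨a (e f), W₂.invariant a ha _ (e f).2⟩ :=
          Subtype.ext (he a ha f)
        rw [LinearEquiv.trans_apply, h, he' a ha (e f), LinearEquiv.trans_apply] }

/-- The set of equivalence classes of irreducible subrepresentations. -/
def IrrClass {n : ℕ} (𝒜 : Subalgebra ℝ (Module.End ℂ (Sch n))) : Type :=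
  Quotient (irrSetoid 𝒜)

/-- The class of an irreducible subrepresentation. -/
def IrrSubrep.cls {n : ℕ} {𝒜 : Subalgebra ℝ (Module.End ℂ (Sch n))} (W : IrrSubrep 𝒜) :
    IrrClass 𝒜 :=
  Quotient.mk (irrSetoid 𝒜) W

/-! ### Coherent states -/

/-- The representation `π` of the Heisenberg group, on functions:
`(π((x, y), t) f)(z) = exp(i (t + ⟨x, z - y/2⟩)) f(z - y)`. -/
def heis {n : ℕ} (h : V n) (t : ℝ) (f : EuclideanSpace ℝ (Fin n) → ℂ) :
    EuclideanSpace ℝ (Fin n) → ℂ := fun z =>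
  Complex.exp (Complex.I *
    ((t + inner ℝ (fstV h) (z - (1 / 2 : ℝ) • sndV h) : ℝ) : ℂ)) * f (z - sndV h)

/-- The Gaussian `f_{0,T}(z) = exp(-(i/2) ⟨z, T⁻¹ z⟩)` annihilated by all `σ_T(v)`. -/
def gauss {n : ℕ} (T : Siegel n) : EuclideanSpace ℝ (Fin n) → ℂ := fun z =>
  Complex.exp (-(Complex.I / 2) *
    ((fun j => (z j : ℂ)) ⬝ᵥ (T.1⁻¹ *ᵥ fun j => (z j : ℂ))))

/-- The coherent state `f_{h,T} = π(h, 0) f_{0,T}`. -/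
def coherent {n : ℕ} (h : V n) (T : Siegel n) : EuclideanSpace ℝ (Fin n) → ℂ :=
  heis h 0 (gauss T)

/-- The complex line `ℂ · f_{h,T}`, as a subspace of `𝒮(ℝⁿ)`. -/
def cline {n : ℕ} (h : V n) (T : Siegel n) : Submodule ℂ (Sch n) where
  carrier := {f | ∃ c : ℂ, ∀ z, f z = c * coherent h T z}
  zero_mem' := ⟨0, fun z => by simp⟩
  add_mem' := by
    rintro f g ⟨c, hc⟩ ⟨d, hd⟩
    exact ⟨c + d, fun z => by simp [hc, hd, add_mul]⟩
  smul_mem' := by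
    rintro k f ⟨c, hc⟩
    exact ⟨k * c, fun z => by simp [hc, mul_assoc]⟩

end Oscillator

end

open scoped Matrix SchwartzMap LineDeriv ComplexOrder

noncomputable section

namespace Oscillator
-- Since `v - i J_T v` lies in the span of the `a_i - ∑ T_ij b_j`, each `σ_T(v)` is a complex
-- combination of the operators `annih T i`, that is `i x_i + ∑ T_ij ∂_j`. These commute because `T`
-- is symmetric. Conversely, the `σ_T(a_j)` alone recover all of them, by the invertible matrix
-- `aMat T`. Both algebras therefore have the same invariant complex subspaces, namely those stable
-- under the `annih T i` (`invariant_iff`), and the two values of `k` need no separate treatment.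
--
-- An irreducible subspace for finitely many commuting operators is a joint eigenline: it is a
-- simple module over a finitely generated commutative `ℂ`-algebra, whose residue fields are `ℂ` by
-- the Nullstellensatz (`exists_joint_eigenvector`). No topology or closedness is involved. The
-- joint eigenvalue equations form a first order system that prescribes the logarithmic derivative
-- of `f`, so the solutions are the multiples of one Gaussian, `f_{h,T}`
-- (`mem_cline_of_eigenvector`). For `h = (x, y)` its eigenvalues are `i (T x + y)`; as `Im T` is
-- invertible, every vector in `ℂⁿ` arises from exactly one real `h` (`eig_injective`,
-- `eig_surjective`). Equivalent lines have equal eigenvalues, so the classes are parametrized by `h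
-- ∈ V`.
--
-- The rest is orbit counting. The first component of `μ(x, (0, T))` is that of `x`, which gives
-- `G/G₀`. Moreover `σ_T` determines `T` (`sigmaT_injective`), and `G` acts transitively on the
-- pairs `(h, T)`, with `G₀ ∩ G_U` the stabilizer of `(0, iI)`.
/-! ### The annihilation operators and the algebra they generate -/

/-- The `i`-th standard unit vector of `ℝⁿ`. -/
def stdE {n : ℕ} (i : Fin n) : EuclideanSpace ℝ (Fin n) := EuclideanSpace.single i 1

/-- The operator `i xᵢ + ∑ⱼ Tᵢⱼ ∂/∂xⱼ`, the image of `aᵢ - ∑ⱼ Tᵢⱼ bⱼ` under `σ`. -/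
def annih {n : ℕ} (T : Siegel n) (i : Fin n) : Module.End ℂ (Sch n) :=
  Complex.I • mulOp (stdE i) + ∑ j, T.1 i j • derivOp (stdE j)

theorem mulOp_stdE_apply {n : ℕ} (i : Fin n) (f : Sch n) (z : EuclideanSpace ℝ (Fin n)) :
    mulOp (stdE i) f z = z i * f z := by
  simp [mulOp_apply, stdE, EuclideanSpace.inner_single_left]

theorem annih_apply {n : ℕ} (T : Siegel n) (i : Fin n) (f : Sch n)
    (z : EuclideanSpace ℝ (Fin n)) :
    annih T i f z = Complex.I * z i * f z + ∑ j, T.1 i j * fderiv ℝ f z (stdE j) := by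
  simp [annih, mulOp_stdE_apply, derivOp_apply, mul_assoc]

theorem mulOp_comm {n : ℕ} (x y : EuclideanSpace ℝ (Fin n)) :
    mulOp x * mulOp y = mulOp y * mulOp x := by
  ext f z
  simp only [Module.End.mul_apply, mulOp_apply]
  ring

theorem derivOp_comm {n : ℕ} (x y : EuclideanSpace ℝ (Fin n)) :
    derivOp x * derivOp y = derivOp y * derivOp x := by
  ext f z
  have key : ∀ u v : EuclideanSpace ℝ (Fin n),
      (derivOp u * derivOp v) f z = fderiv ℝ (fderiv ℝ f) z u v := fun u v => by
    have h : (derivOp v f : EuclideanSpace ℝ (Fin n) → ℂ) = fun w => fderiv ℝ f w v :=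
      funext fun w => derivOp_apply v w f
    have hd : DifferentiableAt ℝ (fderiv ℝ f) z :=
      ((f.smooth 2).fderiv_right (m := 1) le_rfl).differentiable one_ne_zero z
    rw [Module.End.mul_apply, derivOp_apply, h, fderiv_clm_apply hd (differentiableAt_const _)]
    simp
  rw [key, key]
  exact ((f.smooth 2).contDiffAt.isSymmSndFDerivAt (by simp)) x y

theorem derivOp_mulOp {n : ℕ} (x y : EuclideanSpace ℝ (Fin n)) :
    derivOp y * mulOp x = mulOp x * derivOp y + ((inner ℝ x y : ℝ) : ℂ) • 1 := by
  ext f z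
  have h : (mulOp x f : EuclideanSpace ℝ (Fin n) → ℂ) =
      fun w => (Complex.ofRealCLM.comp (innerSL ℝ x)) w * f w :=
    funext fun w => by rw [mulOp_apply]; simp
  simp only [Module.End.mul_apply, LinearMap.add_apply, add_apply, mulOp_apply,
    derivOp_apply, h]
  rw [fderiv_fun_mul (ContinuousLinearMap.differentiableAt _) f.differentiableAt]
  simp
  ring

/-- The multiplications commute, as do the derivatives. The mixed terms contribute `i (T_ij -
T_ji)`, which vanishes by symmetry of `T`. -/
theorem annih_comm {n : ℕ} (T : Siegel n) (i j : Fin n) :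
    annih T i * annih T j = annih T j * annih T i := by
  have cross : ∀ k l : Fin n, (∑ j, T.1 k j • derivOp (stdE j)) * mulOp (stdE l) =
      mulOp (stdE l) * (∑ j, T.1 k j • derivOp (stdE j)) + T.1 k l • 1 := fun k l => by
    simp only [Finset.sum_mul, Finset.mul_sum, smul_mul_assoc, mul_smul_comm, derivOp_mulOp,
      smul_add, Finset.sum_add_distrib]
    congr 1
    rw [Finset.sum_eq_single l]
    · simp [stdE]
    · intro b _ hb
      simp [stdE, EuclideanSpace.inner_single_left, hb.symm]
    · simp
  have hd : (∑ k, T.1 i k • derivOp (stdE (n := n) k)) * (∑ k, T.1 j k • derivOp (stdE k)) =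
      (∑ k, T.1 j k • derivOp (stdE k)) * (∑ k, T.1 i k • derivOp (stdE k)) := by
    simp only [Finset.sum_mul, Finset.mul_sum, smul_mul_assoc, mul_smul_comm, Finset.smul_sum]
    rw [Finset.sum_comm]
    refine Finset.sum_congr rfl fun a _ => Finset.sum_congr rfl fun b _ => ?_
    rw [derivOp_comm, smul_comm]
  simp only [annih, mul_add, add_mul, smul_mul_assoc, mul_smul_comm, cross, hd, smul_add,
    mulOp_comm (stdE i) (stdE j), T.2.1.apply i j]
  abel

theorem mulOp_eq_sum {n : ℕ} (x : EuclideanSpace ℝ (Fin n)) :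
    mulOp x = ∑ i, (x i : ℂ) • mulOp (stdE i) := by
  ext f z
  simp [mulOp_apply, stdE, PiLp.inner_apply, Finset.sum_mul, mul_assoc, mul_comm]

theorem derivOp_eq_sum {n : ℕ} (x : EuclideanSpace ℝ (Fin n)) :
    derivOp x = ∑ i, (x i : ℂ) • derivOp (stdE i) := by
  ext f z
  have hx : x = ∑ i, x i • stdE i := by
    ext k; simp [stdE, Finset.sum_apply, Pi.single_apply]
  rw [derivOp_apply]
  conv_lhs => rw [hx]
  simp [derivOp_apply]

theorem sigma_eq_sum {n : ℕ} (v : V n) :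
    sigma n v = ∑ i, ((v (Sum.inl i) : ℂ) • Complex.I • mulOp (stdE i) -
      (v (Sum.inr i) : ℂ) • derivOp (stdE i)) := by
  change Complex.I • mulOp (fstV v) - derivOp (sndV v) = _
  rw [mulOp_eq_sum, derivOp_eq_sum, Finset.sum_sub_distrib, Finset.smul_sum]
  simp only [smul_comm Complex.I]
  rfl

/-- The `aᵢ`-coordinate of `v - i J_T v`. -/
def aCoord {n : ℕ} (T : Siegel n) (v : V n) (i : Fin n) : ℂ :=
  (v (Sum.inl i) : ℂ) - Complex.I * (cplxStr T *ᵥ v) (Sum.inl i)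

/-- A vector in the span of the `a_i - ∑ T_ij b_j` is determined by its `a`-coordinates, which are
its coefficients there; `cplxStr_spec` supplies the membership. -/
theorem sigmaT_eq_sum {n : ℕ} (T : Siegel n) (v : V n) :
    sigmaT T v = ∑ i, aCoord T v i • annih T i := by
  have h : sigmaT T v = ∑ i, (aCoord T v i • Complex.I • mulOp (stdE i) -
      ((v (Sum.inr i) : ℂ) - Complex.I * (cplxStr T *ᵥ v) (Sum.inr i)) • derivOp (stdE i)) := by
    change sigma n v - Complex.I • sigma n (cplxStr T *ᵥ v) = _
    rw [sigma_eq_sum, sigma_eq_sum, Finset.smul_sum, ← Finset.sum_sub_distrib]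
    refine Finset.sum_congr rfl fun i _ => ?_
    simp only [aCoord, sub_smul, smul_sub, mul_smul]
    abel
  rw [h]
  simp only [cplxStr_spec, annih, smul_add, Finset.sum_add_distrib, neg_smul,
    sub_neg_eq_add, Finset.smul_sum, Finset.sum_smul]
  congr 1
  rw [Finset.sum_comm]
  refine Finset.sum_congr rfl fun i _ => Finset.sum_congr rfl fun j _ => ?_
  rw [T.2.1.apply i j, smul_smul, mul_comm]
  rfl

/-- For `g = (0 -1; 1 0)` the denominator `A - B T` is `T` itself, so `den_isUnit` applies. -/
theorem siegel_det_isUnit {n : ℕ} (T : Siegel n) : IsUnit T.1.det := by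
  have h := den_isUnit (SymplecticGroup.symJ (Fin n) ℝ) T
  have e : den (SymplecticGroup.symJ (Fin n) ℝ) T.1 = T.1 := by
    have : (SymplecticGroup.symJ (Fin n) ℝ).1 = Matrix.fromBlocks 0 (-1) 1 0 := rfl
    rw [den, this, Matrix.toBlocks_fromBlocks₁₁, Matrix.toBlocks_fromBlocks₁₂]
    ext i j
    simp [cx, Matrix.mul_apply, Matrix.one_apply, apply_ite]
  rwa [e] at h

/-- The matrix whose `j`-th row are the `a`-coordinates of `aⱼ - i J_T aⱼ`. -/
def aMat {n : ℕ} (T : Siegel n) : Matrix (Fin n) (Fin n) ℂ :=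
  Matrix.of fun j k => aCoord T (vecA j) k

theorem aMat_eq {n : ℕ} (T : Siegel n) :
    aMat T = 1 + Complex.I • cx (((T.1.map Complex.im)⁻¹ * T.1.map Complex.re)ᵀ) := by
  ext j k
  have h : (cplxStr T *ᵥ vecA j) (Sum.inl k) =
      -((T.1.map Complex.im)⁻¹ * T.1.map Complex.re) k j := by
    simp [cplxStr, vecA]
  simp only [aMat, Matrix.of_apply, aCoord, h]
  simp [vecA, cx, Matrix.one_apply, Pi.single_apply, eq_comm, apply_ite, -Matrix.transpose_mul]

theorem aMat_isUnit {n : ℕ} (T : Siegel n) : IsUnit (aMat T).det := by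
  have hY : IsUnit (T.1.map Complex.im).det :=
    (Matrix.isUnit_iff_isUnit_det _).1 T.2.2.isUnit
  have hs : T.1ᵀ = T.1 := T.2.1
  have hXs : (T.1.map Complex.re)ᵀ = T.1.map Complex.re := by
    rw [← Matrix.transpose_map, hs]
  have hYs : (T.1.map Complex.im)ᵀ = T.1.map Complex.im := by
    rw [← Matrix.transpose_map, hs]
  -- With `T = X + iY`, the matrix is `1 + i X Y⁻¹`. Multiplying by `Y` gives `Y + iX = i (X - iY)`,
  -- whose determinant is nonzero because that of `T` is.
  have key : aMat T * cx (T.1.map Complex.im) = Complex.I • T.1ᴴ := by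
    rw [aMat_eq, Matrix.transpose_mul, Matrix.transpose_nonsing_inv, hXs, hYs, Matrix.add_mul,
      Matrix.smul_mul, ← cx_mul, Matrix.mul_assoc, Matrix.nonsing_inv_mul _ hY, Matrix.mul_one,
      Matrix.one_mul]
    ext i j
    have := T.2.1.apply i j
    apply Complex.ext <;> simp [cx, Matrix.conjTranspose_apply, this]
  have h := congrArg Matrix.det key
  rw [Matrix.det_mul, Matrix.det_smul, Matrix.det_conjTranspose] at h
  refine isUnit_of_mul_isUnit_left (y := (cx (T.1.map Complex.im)).det) ?_
  rw [h]
  exact ((isUnit_iff_ne_zero.2 Complex.I_ne_zero).pow _).mul (siegel_det_isUnit T).star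

/-! ### Irreducible subspaces of commuting families of operators -/

section Schur

/-- Every element of a finitely generated commutative complex algebra is a scalar modulo a given
maximal ideal. -/
theorem exists_sub_algebraMap_mem {B : Type*} [CommRing B] [Algebra ℂ B] [Algebra.FiniteType ℂ B]
    (m : Ideal B) [m.IsMaximal] (b : B) : ∃ c : ℂ, b - algebraMap ℂ B c ∈ m := by
  let : Field (B ⧸ m) := Ideal.Quotient.field m
  have hft : Algebra.FiniteType ℂ (B ⧸ m) :=
    Algebra.FiniteType.of_surjective (Ideal.Quotient.mkₐ ℂ m) (Ideal.Quotient.mkₐ_surjective ℂ m)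
  -- Zariski's lemma: a field finitely generated as a `ℂ`-algebra is finite over `ℂ`, hence equal to
  -- `ℂ`.
  have hfin := finite_of_finite_type_of_isJacobsonRing ℂ (B ⧸ m)
  have hint : Algebra.IsIntegral ℂ (B ⧸ m) := Algebra.IsIntegral.of_finite ℂ _
  obtain ⟨c, hc⟩ := (IsAlgClosed.algebraMap_bijective_of_isIntegral (k := ℂ) (K := B ⧸ m)).2
    (Ideal.Quotient.mk m b)
  refine ⟨c, ?_⟩
  rw [← Ideal.Quotient.eq, ← hc]
  rfl

variable {E ι : Type*} [AddCommGroup E] [Module ℂ E] [Finite ι]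

open scoped IsMulCommutative in
/-- A finite commuting family of operators has a joint eigenvector in every non-zero invariant
subspace which has no proper non-zero invariant subspace. -/
theorem exists_joint_eigenvector (D : ι → Module.End ℂ E) (hD : ∀ i j, D i * D j = D j * D i)
    (W : Submodule ℂ E) (hW : ∀ i, ∀ f ∈ W, D i f ∈ W) (h0 : W ≠ ⊥)
    (hirr : ∀ U ≤ W, (∀ i, ∀ f ∈ U, D i f ∈ U) → U = ⊥ ∨ U = W) :
    ∃ w ∈ W, w ≠ 0 ∧ ∃ c : ι → ℂ, ∀ i, D i w = c i • w := by
  obtain ⟨w, hw, hw0⟩ := W.ne_bot_iff.1 h0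
  have hB : IsMulCommutative (Algebra.adjoin ℂ (Set.range D)) := by
    refine Algebra.isMulCommutative_adjoin ℂ ?_
    rintro _ ⟨i, rfl⟩ _ ⟨j, rfl⟩
    exact hD i j
  let B := Algebra.adjoin ℂ (Set.range D)
  let d : ι → B := fun i => ⟨D i, Algebra.subset_adjoin ⟨i, rfl⟩⟩
  have hBW : ∀ b : B, ∀ f ∈ W, b.1 f ∈ W := by
    have : ∀ a ∈ Algebra.adjoin ℂ (Set.range D), ∀ f ∈ W, a f ∈ W := by
      intro a ha
      induction ha using Algebra.adjoin_induction with
      | mem a ha => obtain ⟨i, rfl⟩ := ha; exact hW i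
      | algebraMap r => intro f hf; exact W.smul_mem r hf
      | add a b _ _ ha hb => intro f hf; exact W.add_mem (ha f hf) (hb f hf)
      | mul a b _ _ ha hb => intro f hf; exact ha _ (hb f hf)
    exact fun b => this b.1 b.2
  -- The annihilator of `w`. Once it is known to be maximal, each `D i` is a scalar modulo it, so
  -- `w` is an eigenvector.
  let m : Ideal B :=
    { carrier := {b | b.1 w = 0}
      add_mem' := fun {a b} ha hb => by
        change (a.1 + b.1) w = 0
        rw [LinearMap.add_apply, ha, hb, add_zero]
      zero_mem' := rfl
      smul_mem' := fun a b hb => by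
        change a.1 (b.1 w) = 0
        rw [show b.1 w = 0 from hb, map_zero] }
  have hm : m.IsMaximal := by
    -- If `b w ≠ 0`, then `B · (b w)` is a non-zero invariant subspace of `W`, hence all of `W`. So
    -- `c b w = w` for some `c`, and `c b - 1` lies in the annihilator.
    refine Ideal.isMaximal_iff.2 ⟨fun h => hw0 h, fun J b hmJ hb hbJ => ?_⟩
    let φ : B →ₗ[ℂ] E :=
      { toFun := fun c => c.1 (b.1 w)
        map_add' := fun _ _ => rfl
        map_smul' := fun _ _ => rfl }
    have h1 : LinearMap.range φ ≤ W := by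
      rintro _ ⟨c, rfl⟩
      exact hBW c _ (hBW b w hw)
    rcases hirr _ h1 (by rintro i _ ⟨c, rfl⟩; exact ⟨d i * c, rfl⟩) with h | h
    · have : φ 1 = 0 := by
        rw [← Submodule.mem_bot ℂ, ← h]; exact ⟨1, rfl⟩
      exact absurd this hb
    · obtain ⟨c, hc⟩ : w ∈ LinearMap.range φ := h ▸ hw
      have h2 : c * b - 1 ∈ m := by
        change (c.1 * b.1 - 1) w = 0
        rw [LinearMap.sub_apply, Module.End.mul_apply]
        exact sub_eq_zero.2 hc
      have := J.sub_mem (J.mul_mem_left c hbJ) (hmJ h2)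
      rwa [sub_sub_cancel] at this
  have hft : Algebra.FiniteType ℂ B :=
    (Subalgebra.fg_iff_finiteType _).1 ((Subalgebra.fg_def).2 ⟨_, Set.finite_range D, rfl⟩)
  choose c hc using fun i => exists_sub_algebraMap_mem m (d i)
  refine ⟨w, hw, hw0, c, fun i => ?_⟩
  exact sub_eq_zero.1 (hc i)

end Schur

/-! ### Invariant subspaces of the algebras -/

theorem sigmaT_vecA {n : ℕ} (T : Siegel n) (j : Fin n) :
    sigmaT T (vecA j) = ∑ k, aMat T j k • annih T k :=
  sigmaT_eq_sum T _

theorem annih_eq_sum {n : ℕ} (T : Siegel n) (i : Fin n) :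
    annih T i = ∑ j, (aMat T)⁻¹ i j • sigmaT T (vecA j) := by
  simp only [sigmaT_vecA, Finset.smul_sum, smul_smul]
  rw [Finset.sum_comm]
  simp only [← Finset.sum_smul, ← Matrix.mul_apply]
  rw [Matrix.nonsing_inv_mul _ (aMat_isUnit T)]
  simp [Matrix.one_apply]

theorem sigmaT_vecA_mem {n : ℕ} (T : Siegel n) (i : Fin 2) (j : Fin n) :
    sigmaT T (vecA j) ∈ imAlg i (sigmaT T) := by
  apply Algebra.subset_adjoin
  refine ⟨vecA j, ?_, rfl⟩
  fin_cases i
  · exact ⟨j, rfl⟩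
  · exact Or.inl ⟨j, rfl⟩

/-- The subspaces are complex, so they cannot distinguish the real algebra from its complex span,
and that span contains the `annih T j` for either choice of generators. -/
theorem invariant_iff {n : ℕ} (T : Siegel n) (i : Fin 2) (W : Submodule ℂ (Sch n)) :
    Invariant (imAlg i (sigmaT T)) W ↔ ∀ j, ∀ f ∈ W, annih T j f ∈ W := by
  constructor
  · intro h j f hf
    rw [annih_eq_sum, LinearMap.sum_apply]
    exact W.sum_mem fun k _ => W.smul_mem _ (h _ (sigmaT_vecA_mem T i k) f hf)
  · intro h a ha
    induction ha using Algebra.adjoin_induction with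
    | mem a ha =>
      obtain ⟨v, _, rfl⟩ := ha
      intro f hf
      rw [sigmaT_eq_sum, LinearMap.sum_apply]
      exact W.sum_mem fun k _ => W.smul_mem _ (h k f hf)
    | algebraMap r =>
      intro f hf
      exact W.smul_mem (r : ℂ) hf
    | add a b _ _ ha hb => intro f hf; exact W.add_mem (ha f hf) (hb f hf)
    | mul a b _ _ ha hb => intro f hf; exact ha _ (hb f hf)

/-- Every irreducible subrepresentation is spanned by a joint eigenvector. -/
theorem IrrSubrep.exists_eigenvector {n : ℕ} {T : Siegel n} {i : Fin 2}
    (W : IrrSubrep (imAlg i (sigmaT T))) :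
    ∃ w : Sch n, w ≠ 0 ∧ W.space = ℂ ∙ w ∧ ∃ c : Fin n → ℂ, ∀ j, annih T j w = c j • w := by
  obtain ⟨w, hw, hw0, c, hc⟩ := exists_joint_eigenvector (annih T) (annih_comm T) W.space
    ((invariant_iff T i _).1 W.invariant) W.ne_bot
    (fun U hU h => W.irreducible U hU ((invariant_iff T i _).2 h))
  refine ⟨w, hw0, ?_, c, hc⟩
  have hinv : Invariant (imAlg i (sigmaT T)) (ℂ ∙ w) := by
    rw [invariant_iff]
    intro j f hf
    obtain ⟨a, rfl⟩ := Submodule.mem_span_singleton.1 hf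
    rw [map_smul, hc]
    exact Submodule.smul_mem _ _ (Submodule.smul_mem _ _ (Submodule.mem_span_singleton_self w))
  rcases W.irreducible _ ((Submodule.span_singleton_le_iff_mem _ _).2 hw) hinv with h | h
  · exact absurd (Submodule.span_singleton_eq_bot.1 h) hw0
  · exact h.symm

/-- A line spanned by a joint eigenvector is an irreducible subrepresentation. -/
def irrOfEigenvector {n : ℕ} (T : Siegel n) (i : Fin 2) (W : Submodule ℂ (Sch n)) (w : Sch n)
    (hw : w ≠ 0) (hW : W = ℂ ∙ w) (c : Fin n → ℂ) (hc : ∀ j, annih T j w = c j • w) :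
    IrrSubrep (imAlg i (sigmaT T)) where
  space := W
  invariant := by
    rw [invariant_iff, hW]
    intro j f hf
    obtain ⟨a, rfl⟩ := Submodule.mem_span_singleton.1 hf
    rw [map_smul, hc]
    exact Submodule.smul_mem _ _ (Submodule.smul_mem _ _ (Submodule.mem_span_singleton_self w))
  ne_bot := by rwa [hW, Ne, Submodule.span_singleton_eq_bot]
  irreducible U hU _ := by
    rw [hW] at hU ⊢
    exact (nonzero_span_atom w hw).le_iff.1 hU

/-- Equivalent irreducible subrepresentations have the same joint eigenvalues. -/
theorem IrrSubrep.Equivalent.eigenvalue_eq {n : ℕ} {T : Siegel n} {i : Fin 2}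
    {W W' : IrrSubrep (imAlg i (sigmaT T))} (h : W.Equivalent W') {w w' : Sch n} (hw : w ≠ 0)
    (hWw : W.space = ℂ ∙ w) (hWw' : W'.space = ℂ ∙ w') {c c' : Fin n → ℂ}
    (hc : ∀ j, annih T j w = c j • w) (hc' : ∀ j, annih T j w' = c' j • w') : c = c' := by
  obtain ⟨e, he⟩ := h
  have hwW : w ∈ W.space := hWw ▸ Submodule.mem_span_singleton_self w
  set u : Sch n := (e ⟨w, hwW⟩ : Sch n) with hu
  have hu0 : u ≠ 0 := by
    intro h0
    have h1 : e ⟨w, hwW⟩ = 0 := Subtype.ext h0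
    rw [LinearEquiv.map_eq_zero_iff] at h1
    exact hw (congrArg Subtype.val h1)
  have hu' : ∀ k, annih T k u = c' k • u := by
    have : u ∈ W'.space := (e ⟨w, hwW⟩).2
    rw [hWw'] at this
    obtain ⟨a, ha⟩ := Submodule.mem_span_singleton.1 this
    intro k
    rw [← ha, map_smul, hc', smul_comm]
  -- The `annih T k` need not lie in the real algebra, so the intertwiner is tested on the
  -- `σ_T(a_j)`; their eigenvalues are those of the `annih T k` transformed by `aMat T`.
  have hM : aMat T *ᵥ c = aMat T *ᵥ c' := by
    funext j
    have h1 := he _ (sigmaT_vecA_mem T i j) ⟨w, hwW⟩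
    have h2 : ∀ (x : Sch n) (b : Fin n → ℂ), (∀ k, annih T k x = b k • x) →
        sigmaT T (vecA j) x = (aMat T *ᵥ b) j • x := fun x b hb => by
      simp only [sigmaT_vecA, LinearMap.sum_apply, LinearMap.smul_apply, hb, smul_smul,
        ← Finset.sum_smul]
      rfl
    rw [h2 _ _ hu'] at h1
    have h3 : (⟨sigmaT T (vecA j) w, W.invariant _ (sigmaT_vecA_mem T i j) _ hwW⟩ : W.space) =
        (aMat T *ᵥ c) j • ⟨w, hwW⟩ := Subtype.ext (h2 w c hc)
    rw [h3, map_smul] at h1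
    exact smul_left_injective ℂ hu0 h1
  exact Matrix.mulVec_injective_of_isUnit
    ((Matrix.isUnit_iff_isUnit_det _).2 (aMat_isUnit T)) hM

/-! ### Coherent states are Schwartz functions -/

section Decay

variable {E : Type*} [NormedAddCommGroup E] [NormedSpace ℝ E]

open scoped ContDiff in
/-- If `F' = F · ℓ` with `ℓ` of temperate growth, then rapid decay of `F` implies rapid decay of
all its derivatives. -/
theorem decay_iteratedFDeriv {F : E → ℂ} {ℓ : E → E →L[ℝ] ℂ} (hF : ContDiff ℝ ∞ F)
    (hℓ : ℓ.HasTemperateGrowth) (hd : ∀ z, fderiv ℝ F z = F z • ℓ z)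
    (h0 : ∀ k : ℕ, ∃ C, ∀ z, (1 + ‖z‖) ^ k * ‖F z‖ ≤ C) (m : ℕ) :
    ∀ k : ℕ, ∃ C, ∀ z, (1 + ‖z‖) ^ k * ‖iteratedFDeriv ℝ m F z‖ ≤ C := by
  induction m using Nat.strong_induction_on with
  | _ m ih =>
    cases m with
    | zero => simpa using h0
    | succ m =>
      intro k
      -- The derivatives of `ℓ` up to order `m` grow at most like `K (1 + ‖z‖) ^ N`. In the Leibniz
      -- expansion of `F • ℓ` this is absorbed by using the induction hypothesis with exponent `k +
      -- N`.
      obtain ⟨N, K, hK, hb⟩ := hℓ.norm_iteratedFDeriv_le_uniform m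
      choose! C hC using fun i (hi : i < m + 1) => ih i hi (k + N)
      refine ⟨∑ i ∈ Finset.range (m + 1), (m.choose i : ℝ) * (C i * K), fun z => ?_⟩
      have e : fderiv ℝ F = fun z => F z • ℓ z := funext hd
      rw [← norm_iteratedFDeriv_fderiv, e]
      have h1 : (0 : ℝ) ≤ 1 + ‖z‖ := by positivity
      calc (1 + ‖z‖) ^ k * ‖iteratedFDeriv ℝ m (fun z => F z • ℓ z) z‖
          ≤ (1 + ‖z‖) ^ k * ∑ i ∈ Finset.range (m + 1), (m.choose i : ℝ) *
              ‖iteratedFDeriv ℝ i F z‖ * ‖iteratedFDeriv ℝ (m - i) ℓ z‖ := by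
            gcongr
            exact norm_iteratedFDeriv_smul_le hF hℓ.1 z (mod_cast le_top)
        _ ≤ _ := by
            rw [Finset.mul_sum]
            refine Finset.sum_le_sum fun i hi => ?_
            calc (1 + ‖z‖) ^ k * ((m.choose i : ℝ) * ‖iteratedFDeriv ℝ i F z‖ *
                    ‖iteratedFDeriv ℝ (m - i) ℓ z‖)
                ≤ (1 + ‖z‖) ^ k * ((m.choose i : ℝ) * ‖iteratedFDeriv ℝ i F z‖ *
                    (K * (1 + ‖z‖) ^ N)) := by
                  gcongr
                  exact hb _ (Nat.sub_le _ _) z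
              _ = (m.choose i : ℝ) * (((1 + ‖z‖) ^ (k + N) * ‖iteratedFDeriv ℝ i F z‖) * K) := by
                  ring
              _ ≤ _ := by
                  gcongr
                  exact hC i (Finset.mem_range.1 hi) z

end Decay

/-- With `r = ‖z - y‖`, one has `1 + ‖z‖ ≤ (1 + ‖y‖) exp r`, and completing the square gives `k r -
a r² ≤ k² / (4a)`. -/
theorem one_add_norm_pow_mul_exp_le {E : Type*} [SeminormedAddCommGroup E] {a : ℝ} (ha : 0 < a)
    (y z : E) (k : ℕ) :
    (1 + ‖z‖) ^ k * Real.exp (-(a * ‖z - y‖ ^ 2)) ≤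
      (1 + ‖y‖) ^ k * Real.exp (k ^ 2 / (4 * a)) := by
  have h1 : 1 + ‖z‖ ≤ (1 + ‖y‖) * Real.exp ‖z - y‖ := by
    have e1 := Real.add_one_le_exp ‖z - y‖
    have e2 : ‖z‖ ≤ ‖z - y‖ + ‖y‖ := by simpa using norm_add_le (z - y) y
    nlinarith [norm_nonneg y, norm_nonneg (z - y)]
  calc (1 + ‖z‖) ^ k * Real.exp (-(a * ‖z - y‖ ^ 2))
      ≤ ((1 + ‖y‖) * Real.exp ‖z - y‖) ^ k * Real.exp (-(a * ‖z - y‖ ^ 2)) := by gcongr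
    _ = (1 + ‖y‖) ^ k * Real.exp (k * ‖z - y‖ + -(a * ‖z - y‖ ^ 2)) := by
        rw [mul_pow, ← Real.exp_nat_mul, mul_assoc, ← Real.exp_add]
    _ ≤ _ := by
        gcongr
        rw [le_div_iff₀ (by positivity)]
        nlinarith [sq_nonneg (2 * a * ‖z - y‖ - k)]

/-- The constant is the minimum of the form on the compact unit sphere; homogeneity extends the
bound to all vectors. For `n = 0` the sphere is empty, hence the case split. -/
theorem posDef_lower_bound {n : ℕ} {Y : Matrix (Fin n) (Fin n) ℝ} (hY : Y.PosDef) :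
    ∃ c > 0, ∀ z : EuclideanSpace ℝ (Fin n), c * ‖z‖ ^ 2 ≤ z.ofLp ⬝ᵥ (Y *ᵥ z.ofLp) := by
  rcases subsingleton_or_nontrivial (EuclideanSpace ℝ (Fin n)) with hE | hE
  · exact ⟨1, one_pos, fun z => by rw [Subsingleton.elim z 0]; simp⟩
  · have hcont : Continuous fun z : EuclideanSpace ℝ (Fin n) => z.ofLp ⬝ᵥ (Y *ᵥ z.ofLp) := by
      unfold dotProduct Matrix.mulVec dotProduct
      fun_prop
    obtain ⟨z₀, hz₀, hmin⟩ := (isCompact_sphere (0 : EuclideanSpace ℝ (Fin n)) 1).exists_isMinOn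
      (NormedSpace.sphere_nonempty.2 zero_le_one) hcont.continuousOn
    have hn : z₀.ofLp ≠ 0 := by
      intro h
      have : z₀ = 0 := by ext i; exact congrFun h i
      rw [this] at hz₀
      simp at hz₀
    have hpos := hY.dotProduct_mulVec_pos hn
    simp only [star_trivial] at hpos
    refine ⟨_, hpos, fun z => ?_⟩
    rcases eq_or_ne z 0 with rfl | hz
    · simp
    · have hz' : ‖z‖ ≠ 0 := norm_ne_zero_iff.2 hz
      have h := hmin (show ‖z‖⁻¹ • z ∈ Metric.sphere (0 : EuclideanSpace ℝ (Fin n)) 1 by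
        simp [norm_smul, hz'])
      simp only [Set.mem_ofPred_eq, WithLp.ofLp_smul, Matrix.mulVec_smul, smul_dotProduct,
        dotProduct_smul, smul_eq_mul] at h
      calc _ ≤ (‖z‖⁻¹ * (‖z‖⁻¹ * z.ofLp ⬝ᵥ (Y *ᵥ z.ofLp))) * ‖z‖ ^ 2 := by gcongr
        _ = _ := by field_simp

/-- The complex bilinear form `(u, v) ↦ ⟨u, S v⟩` on real vectors. -/
def bilin {n : ℕ} (S : Matrix (Fin n) (Fin n) ℂ) :
    EuclideanSpace ℝ (Fin n) →L[ℝ] EuclideanSpace ℝ (Fin n) →L[ℝ] ℂ :=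
  ∑ i, ∑ j, (EuclideanSpace.proj i : EuclideanSpace ℝ (Fin n) →L[ℝ] ℝ).smulRight
    (S i j • Complex.ofRealCLM.comp (EuclideanSpace.proj j : EuclideanSpace ℝ (Fin n) →L[ℝ] ℝ))

theorem bilin_apply {n : ℕ} (S : Matrix (Fin n) (Fin n) ℂ) (u v : EuclideanSpace ℝ (Fin n)) :
    bilin S u v = (fun j => (u j : ℂ)) ⬝ᵥ (S *ᵥ fun j => (v j : ℂ)) := by
  simp [bilin, dotProduct, Matrix.mulVec, Finset.mul_sum]

theorem bilin_comm {n : ℕ} {S : Matrix (Fin n) (Fin n) ℂ} (hS : S.IsSymm)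
    (u v : EuclideanSpace ℝ (Fin n)) : bilin S u v = bilin S v u := by
  rw [bilin_apply, bilin_apply, Matrix.dotProduct_mulVec, ← Matrix.mulVec_transpose, hS,
    dotProduct_comm]

/-- The exponent of `f_{h,T}`. -/
def phase {n : ℕ} (h : V n) (T : Siegel n) (z : EuclideanSpace ℝ (Fin n)) : ℂ :=
  Complex.I * ((inner ℝ (fstV h) (z - (1 / 2 : ℝ) • sndV h) : ℝ) : ℂ) -
    Complex.I / 2 * bilin T.1⁻¹ (z - sndV h) (z - sndV h)

/-- The derivative of the exponent of `f_{h,T}`. -/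
def dphase {n : ℕ} (h : V n) (T : Siegel n) (z : EuclideanSpace ℝ (Fin n)) :
    EuclideanSpace ℝ (Fin n) →L[ℝ] ℂ :=
  Complex.I • Complex.ofRealCLM.comp (innerSL ℝ (fstV h)) -
    Complex.I • bilin T.1⁻¹ (z - sndV h)

theorem coherent_eq_exp {n : ℕ} (h : V n) (T : Siegel n) (z : EuclideanSpace ℝ (Fin n)) :
    coherent h T z = Complex.exp (phase h T z) := by
  simp only [coherent, heis, gauss, phase, bilin_apply, ← Complex.exp_add, zero_add]
  congr 1
  rw [sub_eq_add_neg, neg_mul]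
  rfl

theorem inv_isSymm {n : ℕ} (T : Siegel n) : T.1⁻¹.IsSymm := by
  have : T.1ᵀ = T.1 := T.2.1
  rw [Matrix.IsSymm, Matrix.transpose_nonsing_inv, this]

theorem hasFDerivAt_phase {n : ℕ} (h : V n) (T : Siegel n) (z : EuclideanSpace ℝ (Fin n)) :
    HasFDerivAt (phase h T) (dphase h T z) z := by
  have h1 : HasFDerivAt (fun z : EuclideanSpace ℝ (Fin n) => z - sndV h)
      (ContinuousLinearMap.id ℝ _) z := (hasFDerivAt_id z).sub_const _
  have h2 := (bilin T.1⁻¹).hasFDerivAt_of_bilinear h1 h1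
  have h3 : HasFDerivAt (fun z : EuclideanSpace ℝ (Fin n) =>
      ((inner ℝ (fstV h) (z - (1 / 2 : ℝ) • sndV h) : ℝ) : ℂ))
      (Complex.ofRealCLM.comp (innerSL ℝ (fstV h))) z := by
    have := (Complex.ofRealCLM.comp (innerSL ℝ (fstV h))).hasFDerivAt
      (x := z - (1 / 2 : ℝ) • sndV h)
    exact this.comp z ((hasFDerivAt_id z).sub_const _)
  have h4 := (h3.const_mul Complex.I).sub (h2.const_mul (Complex.I / 2))
  refine h4.congr_fderiv ?_
  ext v
  change Complex.I * _ - Complex.I / 2 * (bilin T.1⁻¹ (z - sndV h) v + bilin T.1⁻¹ v (z - sndV h)) =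
    Complex.I * _ - Complex.I * bilin T.1⁻¹ (z - sndV h) v
  rw [bilin_comm (inv_isSymm T) v]
  ring

theorem hasTemperateGrowth_dphase {n : ℕ} (h : V n) (T : Siegel n) :
    (dphase h T).HasTemperateGrowth := by
  -- The exponent is quadratic, so its derivative is affine in `z`: a constant minus a continuous
  -- linear map.
  have e : dphase h T = fun z => (Complex.I • Complex.ofRealCLM.comp (innerSL ℝ (fstV h)) +
      Complex.I • bilin T.1⁻¹ (sndV h)) - (Complex.I • bilin T.1⁻¹) z := by
    funext z
    simp only [dphase, map_sub, smul_sub, smul_apply]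
    abel
  rw [e]
  exact (Function.HasTemperateGrowth.const _).sub (ContinuousLinearMap.hasTemperateGrowth _)

open scoped ContDiff in
theorem contDiff_phase {n : ℕ} (h : V n) (T : Siegel n) : ContDiff ℝ ∞ (phase h T) := by
  rw [contDiff_infty_iff_fderiv]
  refine ⟨fun z => (hasFDerivAt_phase h T z).differentiableAt, ?_⟩
  rw [show fderiv ℝ (phase h T) = dphase h T from
    funext fun z => (hasFDerivAt_phase h T z).fderiv]
  exact (hasTemperateGrowth_dphase h T).1

theorem hasFDerivAt_coherent {n : ℕ} (h : V n) (T : Siegel n) (z : EuclideanSpace ℝ (Fin n)) :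
    HasFDerivAt (coherent h T) (coherent h T z • dphase h T z) z := by
  rw [coherent_eq_exp, show coherent h T = fun z => Complex.exp (phase h T z) from
    funext (coherent_eq_exp h T)]
  exact (hasFDerivAt_phase h T z).cexp

/-- The symplectic matrix `(0 -1; 1 0)` sends `T` to `-T⁻¹`, which therefore lies in Siegel space.
This makes the Gaussian decay. -/
theorem neg_inv_im_posDef {n : ℕ} (T : Siegel n) : ((-T.1⁻¹).map Complex.im).PosDef := by
  have h := (spAct (SymplecticGroup.symJ (Fin n) ℝ) T).2.2
  have hJ : (SymplecticGroup.symJ (Fin n) ℝ).1 = Matrix.fromBlocks 0 (-1) 1 0 := rfl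
  have e : (spAct (SymplecticGroup.symJ (Fin n) ℝ) T).1 = -T.1⁻¹ := by
    have c : cx (-1 : Matrix (Fin n) (Fin n) ℝ) = -1 := by
      rw [← zero_sub, cx_sub, cx_zero, cx_one, zero_sub]
    change num _ T.1 * (den _ T.1)⁻¹ = _
    rw [num, den, hJ, Matrix.toBlocks_fromBlocks₁₁, Matrix.toBlocks_fromBlocks₁₂,
      Matrix.toBlocks_fromBlocks₂₁, Matrix.toBlocks_fromBlocks₂₂, cx_zero, cx_one, c]
    simp
  rwa [e] at h

theorem norm_coherent {n : ℕ} (h : V n) (T : Siegel n) (z : EuclideanSpace ℝ (Fin n)) :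
    ‖coherent h T z‖ = Real.exp (-(1 / 2 * ((z - sndV h).ofLp ⬝ᵥ
      ((-T.1⁻¹).map Complex.im *ᵥ (z - sndV h).ofLp)))) := by
  rw [coherent_eq_exp, Complex.norm_exp, phase, bilin_apply]
  congr 1
  have key : ∀ (S : Matrix (Fin n) (Fin n) ℂ) (u : Fin n → ℝ),
      ((fun j => (u j : ℂ)) ⬝ᵥ (S *ᵥ fun j => (u j : ℂ))).im = u ⬝ᵥ (S.map Complex.im *ᵥ u) := by
    intro S u
    simp [dotProduct, Matrix.mulVec, Finset.mul_sum]
  have hneg : (-T.1⁻¹).map Complex.im = -(T.1⁻¹.map Complex.im) := by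
    ext i j; simp
  rw [hneg, Matrix.neg_mulVec, dotProduct_neg, ← key]
  generalize (fun j => (((z - sndV h).ofLp j : ℝ) : ℂ)) ⬝ᵥ
    (T.1⁻¹ *ᵥ fun j => (((z - sndV h).ofLp j : ℝ) : ℂ)) = q
  simp

/-- The coherent state `f_{h,T}` as a Schwartz function. -/
def cohSch {n : ℕ} (h : V n) (T : Siegel n) : Sch n where
  toFun := coherent h T
  smooth' := by
    rw [show coherent h T = fun z => Complex.exp (phase h T z) from
      funext (coherent_eq_exp h T)]
    exact (contDiff_phase h T).cexp
  decay' k m := by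
    have hs : ContDiff ℝ (⊤ : ℕ∞) (coherent h T) := by
      rw [show coherent h T = fun z => Complex.exp (phase h T z) from
        funext (coherent_eq_exp h T)]
      exact (contDiff_phase h T).cexp
    obtain ⟨c, hc, hb⟩ := posDef_lower_bound (neg_inv_im_posDef T)
    obtain ⟨C, hC⟩ := decay_iteratedFDeriv hs (hasTemperateGrowth_dphase h T)
      (fun z => (hasFDerivAt_coherent h T z).fderiv)
      -- The modulus is at most `exp (-(c/2) ‖z - y‖²)` with `y = sndV h`, so the Gaussian bound is
      -- used with `a = c / 2`.
      (fun k => ⟨(1 + ‖sndV h‖) ^ k * Real.exp (k ^ 2 / (4 * (c / 2))), fun z => by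
        refine le_trans ?_ (one_add_norm_pow_mul_exp_le (half_pos hc) (sndV h) z k)
        rw [norm_coherent]
        refine mul_le_mul_of_nonneg_left (Real.exp_le_exp.2 ?_) (by positivity)
        have := hb (z - sndV h)
        linarith⟩) m k
    refine ⟨C, fun z => le_trans ?_ (hC z)⟩
    gcongr
    linarith [norm_nonneg z]

theorem cohSch_apply {n : ℕ} (h : V n) (T : Siegel n) (z : EuclideanSpace ℝ (Fin n)) :
    cohSch h T z = coherent h T z := rfl

theorem coherent_ne_zero {n : ℕ} (h : V n) (T : Siegel n) (z : EuclideanSpace ℝ (Fin n)) :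
    coherent h T z ≠ 0 := by
  rw [coherent_eq_exp]; exact Complex.exp_ne_zero _

theorem cohSch_ne_zero {n : ℕ} (h : V n) (T : Siegel n) : cohSch h T ≠ 0 := fun h0 =>
  coherent_ne_zero h T 0 (by rw [← cohSch_apply, h0]; rfl)

theorem cline_eq_span {n : ℕ} (h : V n) (T : Siegel n) : cline h T = ℂ ∙ cohSch h T := by
  ext f
  rw [Submodule.mem_span_singleton]
  constructor
  · rintro ⟨c, hc⟩
    exact ⟨c, by ext z; simp [hc, cohSch_apply]⟩
  · rintro ⟨c, rfl⟩
    exact ⟨c, fun z => by simp [cohSch_apply]⟩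

/-! ### Joint eigenvectors of the annihilation operators -/

/-- The joint eigenvalues of the annihilation operators on `f_{h,T}`, `h = (x, y)`:
`i (T x + y)`. -/
def eig {n : ℕ} (h : V n) (T : Siegel n) (i : Fin n) : ℂ :=
  Complex.I * ((∑ j, T.1 i j * h (Sum.inl j)) + h (Sum.inr i))

theorem dphase_stdE {n : ℕ} (h : V n) (T : Siegel n) (z : EuclideanSpace ℝ (Fin n)) (j : Fin n) :
    dphase h T z (stdE j) =
      Complex.I * (h (Sum.inl j) - (T.1⁻¹ *ᵥ fun k => ((z k - h (Sum.inr k) : ℝ) : ℂ)) j) := by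
  have h1 : bilin T.1⁻¹ (z - sndV h) (stdE j) =
      (T.1⁻¹ *ᵥ fun k => ((z k - h (Sum.inr k) : ℝ) : ℂ)) j := by
    rw [bilin_comm (inv_isSymm T), bilin_apply]
    simp [dotProduct, stdE, apply_ite, sndV]
  have h2 : inner ℝ (fstV h) (stdE j) = h (Sum.inl j) := by
    simp [stdE, fstV, EuclideanSpace.inner_single_right]
  change Complex.I * ((inner ℝ (fstV h) (stdE j) : ℝ) : ℂ) -
    Complex.I * bilin T.1⁻¹ (z - sndV h) (stdE j) = _
  rw [h1, h2, mul_sub]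

/-- Applying `T` cancels `T⁻¹` in the derivative, leaving `i T x - i (z - y)`; adding `i z` removes
all dependence on `z`. -/
theorem dphase_eigen {n : ℕ} (h : V n) (T : Siegel n) (z : EuclideanSpace ℝ (Fin n)) (i : Fin n) :
    Complex.I * z i + ∑ j, T.1 i j * dphase h T z (stdE j) = eig h T i := by
  have e : ∀ w : Fin n → ℂ, ∑ j, T.1 i j * (T.1⁻¹ *ᵥ w) j = w i := fun w => by
    change (T.1 *ᵥ (T.1⁻¹ *ᵥ w)) i = w i
    rw [Matrix.mulVec_mulVec, Matrix.mul_nonsing_inv _ (siegel_det_isUnit T), Matrix.one_mulVec]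
  simp only [dphase_stdE, mul_left_comm _ Complex.I, ← Finset.mul_sum, mul_sub,
    Finset.sum_sub_distrib, e, eig]
  push_cast
  ring

theorem annih_cohSch {n : ℕ} (h : V n) (T : Siegel n) (i : Fin n) :
    annih T i (cohSch h T) = eig h T i • cohSch h T := by
  ext z
  have hd : fderiv ℝ (cohSch h T) z = coherent h T z • dphase h T z :=
    (hasFDerivAt_coherent h T z).fderiv
  rw [annih_apply, hd, ← dphase_eigen h T z i]
  simp [cohSch_apply, add_mul, Finset.sum_mul, mul_assoc, mul_comm (coherent h T z)]

theorem mem_cline_of_eigenvector {n : ℕ} (h : V n) (T : Siegel n) (f : Sch n)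
    (hf : ∀ i, annih T i f = eig h T i • f) : f ∈ cline h T := by
  have hfd : ∀ z, fderiv ℝ f z = f z • dphase h T z := by
    intro z
    -- The eigenvalue equations determine only `T` applied to the gradient of `f`; invertibility of
    -- `T` then yields every partial derivative.
    have h1 : T.1 *ᵥ (fun j => fderiv ℝ f z (stdE j) - f z * dphase h T z (stdE j)) = 0 := by
      funext i
      have e1 := congrArg (fun g : Sch n => g z) (hf i)
      simp only [annih_apply, smul_apply, smul_eq_mul] at e1
      rw [← dphase_eigen h T z i] at e1
      have e2 : ∑ j, T.1 i j * (f z * dphase h T z (stdE j)) =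
          f z * ∑ j, T.1 i j * dphase h T z (stdE j) := by
        rw [Finset.mul_sum]
        exact Finset.sum_congr rfl fun _ _ => by ring
      simp only [Matrix.mulVec, dotProduct, mul_sub, Finset.sum_sub_distrib, e2, Pi.zero_apply]
      linear_combination e1
    have h2 : (fun j => fderiv ℝ f z (stdE j) - f z * dphase h T z (stdE j)) = 0 :=
      Matrix.mulVec_injective_of_isUnit
        ((Matrix.isUnit_iff_isUnit_det _).2 (siegel_det_isUnit T)) (by rw [h1, Matrix.mulVec_zero])
    apply ContinuousLinearMap.coe_injective
    refine (EuclideanSpace.basisFun (Fin n) ℝ).toBasis.ext fun j => ?_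
    have := congrFun h2 j
    simpa [sub_eq_zero, stdE] using this
  -- Dividing by `exp (phase h T z)`, which solves the same equation, leaves a function with zero
  -- derivative, hence a constant.
  have hg : ∀ z, HasFDerivAt (fun z => f z * Complex.exp (-phase h T z))
      (0 : EuclideanSpace ℝ (Fin n) →L[ℝ] ℂ) z := by
    intro z
    have := (f.differentiableAt (x := z)).hasFDerivAt.mul (hasFDerivAt_phase h T z).neg.cexp
    refine this.congr_fderiv ?_
    rw [hfd]
    ext v
    simp
    ring
  refine ⟨f 0 * Complex.exp (-phase h T 0), fun z => ?_⟩
  have := is_const_of_fderiv_eq_zero (𝕜 := ℝ) (fun z => (hg z).differentiableAt)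
    (fun z => (hg z).fderiv) z 0
  rw [← this, coherent_eq_exp, mul_assoc, ← Complex.exp_add]
  simp

/-- For real `x` and `y`, the imaginary part of `T x + y` is `(Im T) x`, which determines `x`; then
`y` is determined too. -/
theorem eig_injective {n : ℕ} (T : Siegel n) : Function.Injective fun h : V n => eig h T := by
  intro h h' e
  have e1 : ∀ i, (∑ j, T.1 i j * h (Sum.inl j)) + h (Sum.inr i) =
      (∑ j, T.1 i j * h' (Sum.inl j)) + h' (Sum.inr i) := fun i =>
    mul_left_cancel₀ Complex.I_ne_zero (congrFun e i)
  have hx : (fun j => h (Sum.inl j)) = fun j => h' (Sum.inl j) := by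
    refine Matrix.mulVec_injective_of_isUnit T.2.2.isUnit ?_
    funext i
    have := congrArg Complex.im (e1 i)
    simpa [Matrix.mulVec, dotProduct] using this
  funext k
  rcases k with k | k
  · exact congrFun hx k
  · have := e1 k
    simp only [fun j => congrFun hx j] at this
    exact_mod_cast add_left_cancel this

/-- Solve `T x + y = -i c`: the imaginary part gives `x` by inverting `Im T`, and the real part then
gives `y`. -/
theorem eig_surjective {n : ℕ} (T : Siegel n) (c : Fin n → ℂ) : ∃ h : V n, eig h T = c := by
  have hY : IsUnit (T.1.map Complex.im).det :=
    (Matrix.isUnit_iff_isUnit_det _).1 T.2.2.isUnit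
  set x : Fin n → ℝ := (T.1.map Complex.im)⁻¹ *ᵥ fun i => (-Complex.I * c i).im with hx
  refine ⟨Sum.elim x fun i => (-Complex.I * c i).re - (T.1.map Complex.re *ᵥ x) i, ?_⟩
  have h1 : T.1.map Complex.im *ᵥ x = fun i => (-Complex.I * c i).im := by
    rw [hx, Matrix.mulVec_mulVec, Matrix.mul_nonsing_inv _ hY, Matrix.one_mulVec]
  funext i
  have key : (∑ j, T.1 i j * (x j : ℂ)) +
      (((-Complex.I * c i).re - (T.1.map Complex.re *ᵥ x) i : ℝ) : ℂ) = -Complex.I * c i := by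
    apply Complex.ext
    · simp [Matrix.mulVec, dotProduct]
    · rw [← congrFun h1 i]
      simp [Matrix.mulVec, dotProduct]
  simp only [eig, Sum.elim_inl, Sum.elim_inr]
  rw [key, ← mul_assoc, mul_neg, Complex.I_mul_I, neg_neg, one_mul]

/-! ### Classification of the irreducible subrepresentations -/

/-- The line `ℂ · f_{h,T}` as an irreducible subrepresentation. -/
def cohIrr {n : ℕ} (i : Fin 2) (T : Siegel n) (h : V n) : IrrSubrep (imAlg i (sigmaT T)) :=
  irrOfEigenvector T i (cline h T) (cohSch h T) (cohSch_ne_zero h T) (cline_eq_span h T)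
    (eig h T) (annih_cohSch h T)

theorem IrrSubrep.exists_eq_cline {n : ℕ} {i : Fin 2} {T : Siegel n}
    (W : IrrSubrep (imAlg i (sigmaT T))) : ∃ h, W.space = cline h T := by
  obtain ⟨w, hw0, hW, c, hc⟩ := W.exists_eigenvector
  obtain ⟨h, rfl⟩ := eig_surjective T c
  refine ⟨h, ?_⟩
  have hle : W.space ≤ ℂ ∙ cohSch h T := by
    rw [hW, ← cline_eq_span, Submodule.span_singleton_le_iff_mem]
    exact mem_cline_of_eigenvector h T w hc
  rw [cline_eq_span]
  exact ((nonzero_span_atom _ (cohSch_ne_zero h T)).le_iff.1 hle).resolve_left W.ne_bot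

theorem IrrSubrep.ext_space {n : ℕ} {𝒜 : Subalgebra ℝ (Module.End ℂ (Sch n))}
    {W W' : IrrSubrep 𝒜} (h : W.space = W'.space) : W = W' := by
  cases W; cases W'; cases h; rfl

theorem cohIrr_cls_bijective {n : ℕ} (i : Fin 2) (T : Siegel n) :
    Function.Bijective fun h : V n => (cohIrr i T h).cls := by
  constructor
  · intro h h' e
    have e' : (cohIrr i T h).Equivalent (cohIrr i T h') := Quotient.exact e
    exact eig_injective T (e'.eigenvalue_eq (cohSch_ne_zero h T) (cline_eq_span h T)
      (cline_eq_span h' T) (annih_cohSch h T) (annih_cohSch h' T))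
  · intro c
    obtain ⟨W, rfl⟩ := Quotient.exists_rep c
    obtain ⟨h, hh⟩ := W.exists_eq_cline
    have e : cohIrr i T h = W := IrrSubrep.ext_space hh.symm
    exact ⟨h, congrArg IrrSubrep.cls e⟩

/-- If `σ_T = σ_{T'}`, the operators `annih T i` kill the Gaussian `f_{0,T'}`. Evaluating this at
the unit vectors says that `T T'⁻¹ = 1`. -/
theorem sigmaT_injective {n : ℕ} : Function.Injective (sigmaT (n := n)) := by
  intro T T' e
  have h0 : ∀ i, annih T i (cohSch 0 T') = 0 := fun i => by
    have h1 : ∀ j, annih T' j (cohSch 0 T') = 0 := fun j => by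
      rw [annih_cohSch, show eig 0 T' j = 0 by simp [eig], zero_smul]
    simp [annih_eq_sum T, e, sigmaT_vecA, h1]
  have h1 : T.1 * T'.1⁻¹ = 1 := by
    ext i k
    have h2 := congrArg (fun f : Sch n => f (stdE k)) (h0 i)
    have hd : fderiv ℝ (cohSch 0 T') (stdE k) = coherent 0 T' (stdE k) • dphase 0 T' (stdE k) :=
      (hasFDerivAt_coherent 0 T' _).fderiv
    have h3 : ∀ j, dphase 0 T' (stdE k) (stdE j) = -Complex.I * T'.1⁻¹ j k := fun j => by
      rw [dphase_stdE]
      simp [Matrix.mulVec, dotProduct, stdE, apply_ite]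
    simp only [annih_apply, hd, smul_apply, smul_eq_mul, h3, cohSch_apply] at h2
    have h4 : coherent 0 T' (stdE k) * Complex.I *
        ((1 : Matrix (Fin n) (Fin n) ℂ) i k - (T.1 * T'.1⁻¹) i k) = 0 := by
      refine Eq.trans ?_ h2
      rw [Matrix.mul_apply, mul_sub, Finset.mul_sum, sub_eq_add_neg, ← Finset.sum_neg_distrib]
      congr 1
      · rcases eq_or_ne i k with rfl | hik
        · simp [stdE]
          ring
        · simp [stdE, hik]
      · exact Finset.sum_congr rfl fun _ _ => by ring
    have h5 := (mul_eq_zero.1 h4).resolve_left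
      (mul_ne_zero (coherent_ne_zero _ _ _) Complex.I_ne_zero)
    exact (sub_eq_zero.1 h5).symm
  apply Subtype.ext
  calc T.1 = T.1 * (T'.1⁻¹ * T'.1) := by
        rw [Matrix.nonsing_inv_mul _ (siegel_det_isUnit T'), Matrix.mul_one]
    _ = T'.1 := by rw [← Matrix.mul_assoc, h1, Matrix.one_mul]

/-- The pair consisting of `σ_T` and the class of `ℂ · f_{h,T}`. -/
def cohPair {n : ℕ} (i : Fin 2) (p : V n × Siegel n) :
    (s : Set.range (sigmaT (n := n))) × IrrClass (imAlg i s.1) :=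
  ⟨⟨sigmaT p.2, Set.mem_range_self _⟩, (cohIrr i p.2 p.1).cls⟩

theorem cohPair_bijective {n : ℕ} (i : Fin 2) : Function.Bijective (cohPair (n := n) i) := by
  constructor
  · rintro ⟨h, T⟩ ⟨h', T'⟩ e
    have e1 : T = T' := sigmaT_injective (congrArg (fun s => s.1.1) e)
    subst e1
    have e2 : (cohIrr i T h).cls = (cohIrr i T h').cls := eq_of_heq (Sigma.mk.inj e).2
    rw [(cohIrr_cls_bijective i T).1 e2]
  · rintro ⟨⟨_, T, rfl⟩, c⟩
    obtain ⟨h, rfl⟩ := (cohIrr_cls_bijective i T).2 c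
    exact ⟨(h, T), rfl⟩

/-! ### The action on Siegel space -/

/-- The stabilizer of `i I` in `Sp(2n, ℝ)` is `U(n) = Sp(2n, ℝ) ∩ O(2n)`. -/
theorem spAct_iI_eq_iff {n : ℕ} (g : Sp n) :
    spAct g (iI n) = iI n ↔ g.1 ∈ Matrix.orthogonalGroup (Fin n ⊕ Fin n) ℝ := by
  have hu := den_isUnit g (iI n)
  have h1 : spAct g (iI n) = iI n ↔ num g (iI n).1 = (iI n).1 * den g (iI n).1 := by
    rw [num_eq, Subtype.ext_iff]
    refine ⟨fun h => by rw [h], fun h => ?_⟩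
    exact (Matrix.isUnit_iff_isUnit_det _).2 hu |>.mul_left_injective h
  -- Real and imaginary parts of `i D - C = i (A - i B)` give `D = A` and `C = -B`, which is
  -- commutation with `J`. For a symplectic matrix, commuting with `J` is the same as being
  -- orthogonal.
  have h2 : num g (iI n).1 = (iI n).1 * den g (iI n).1 ↔
      g.1.toBlocks₂₂ = g.1.toBlocks₁₁ ∧ g.1.toBlocks₂₁ = -g.1.toBlocks₁₂ := by
    constructor
    · intro h
      have e : ∀ i j, g.1.toBlocks₂₂ i j = g.1.toBlocks₁₁ i j ∧
          g.1.toBlocks₂₁ i j = -g.1.toBlocks₁₂ i j := fun i j => by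
        have := congrFun (congrFun h i) j
        have hr := congrArg Complex.re this
        have hi := congrArg Complex.im this
        simp [num, den, iI, cx] at hr hi
        exact ⟨hi, by linarith⟩
      exact ⟨Matrix.ext fun i j => (e i j).1, Matrix.ext fun i j => (e i j).2⟩
    · rintro ⟨hD, hC⟩
      ext i j
      apply Complex.ext <;> simp [num, den, iI, cx, hD, hC]
  have h3 : g.1 * Matrix.J (Fin n) ℝ = Matrix.J (Fin n) ℝ * g.1 ↔
      g.1.toBlocks₂₂ = g.1.toBlocks₁₁ ∧ g.1.toBlocks₂₁ = -g.1.toBlocks₁₂ := by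
    conv_lhs => rw [← Matrix.fromBlocks_toBlocks g.1, Matrix.J, Matrix.fromBlocks_multiply,
      Matrix.fromBlocks_multiply, Matrix.fromBlocks_inj]
    simp only [mul_zero, zero_mul, mul_one, one_mul, mul_neg, neg_mul, zero_add, add_zero, neg_inj]
    constructor
    · rintro ⟨h1, h2, h3, h4⟩
      exact ⟨h3, by rw [h1, neg_neg]⟩
    · rintro ⟨h1, h2⟩
      exact ⟨by rw [h2, neg_neg], h1.symm, h1, by rw [h2, neg_neg]⟩
  have hJ : IsUnit (Matrix.J (Fin n) ℝ) :=
    (Matrix.isUnit_iff_isUnit_det _).2 (Matrix.isUnit_det_J _ _)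
  have hs := SymplecticGroup.mem_iff'.1 g.2
  rw [h1, h2, ← h3, Matrix.mem_orthogonalGroup_iff']
  change _ ↔ g.1ᵀ * g.1 = 1
  constructor
  · intro h
    rw [Matrix.mul_assoc, ← h, ← Matrix.mul_assoc] at hs
    exact hJ.mul_left_injective (by simpa using hs)
  · intro h
    have h' : g.1 * g.1ᵀ = 1 := mul_eq_one_comm.1 h
    calc g.1 * Matrix.J (Fin n) ℝ = g.1 * (g.1ᵀ * Matrix.J (Fin n) ℝ * g.1) := by rw [hs]
      _ = (g.1 * g.1ᵀ) * Matrix.J (Fin n) ℝ * g.1 := by noncomm_ring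
      _ = _ := by rw [h', Matrix.one_mul]

-- A positive semidefinite matrix is a nonnegative element of the C⋆-algebra of matrices, hence of
-- the form `star B * B`; invertibility of `Y` passes to `B`.
open scoped MatrixOrder Matrix.Norms.L2Operator in
theorem exists_isUnit_transpose_mul_self {n : ℕ} {Y : Matrix (Fin n) (Fin n) ℝ} (hY : Y.PosDef) :
    ∃ B : Matrix (Fin n) (Fin n) ℝ, IsUnit B.det ∧ Y = Bᵀ * B := by
  obtain ⟨B, hB⟩ := CStarAlgebra.nonneg_iff_eq_star_mul_self.mp hY.posSemidef.nonneg
  have hB' : Y = Bᵀ * B := hB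
  refine ⟨B, ?_, hB'⟩
  have h := (Matrix.isUnit_iff_isUnit_det _).1 hY.isUnit
  rw [hB', Matrix.det_mul] at h
  exact isUnit_of_mul_isUnit_right h

/-- `Mp(2n, ℝ)` acts transitively on Siegel space. -/
theorem exists_mp_spAct_iI {n : ℕ} (T : Siegel n) : ∃ g : Mp n, spAct g.base (iI n) = T := by
  obtain ⟨B, hB, hY⟩ := exists_isUnit_transpose_mul_self T.2.2
  have hs : T.1ᵀ = T.1 := T.2.1
  have hXs : (T.1.map Complex.re)ᵀ = T.1.map Complex.re := by
    rw [← Matrix.transpose_map, hs]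
  have hBB : (B⁻¹)ᵀ * Bᵀ = 1 := by
    rw [← Matrix.transpose_mul, Matrix.mul_nonsing_inv _ hB, Matrix.transpose_one]
  -- With `T = X + iY` and `Y = Bᵀ B`, this matrix has denominator `B⁻¹` and numerator `i Bᵀ + X B⁻¹
  -- = T B⁻¹` at `iI`.
  have hmem : Matrix.fromBlocks B⁻¹ 0 (-(T.1.map Complex.re * B⁻¹)) Bᵀ ∈
      Matrix.symplecticGroup (Fin n) ℝ := by
    rw [SymplecticGroup.fromBlocks_mem_iff]
    refine ⟨?_, by simp, ?_⟩
    · rw [Matrix.transpose_neg, Matrix.transpose_mul, hXs]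
      simp [Matrix.mul_assoc]
    · rw [Matrix.mul_zero, sub_zero, hBB]
  let s : Sp n := ⟨_, hmem⟩
  have hden : ∀ S, den s S = cx B⁻¹ := fun S => by
    rw [den, Matrix.toBlocks_fromBlocks₁₁, Matrix.toBlocks_fromBlocks₁₂, cx_zero]
    simp
  -- The denominator does not depend on the point, so a constant square root is a continuous branch
  -- and lifts `s` to the metaplectic group.
  refine ⟨⟨s, fun _ => (cx B⁻¹).det ^ ((1 : ℂ) / 2), continuous_const, fun S => ?_⟩, ?_⟩
  · rw [hden, ← Complex.cpow_nat_mul]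
    simp
  · apply Subtype.ext
    have hu := den_isUnit s (iI n)
    change num s (iI n).1 * (den s (iI n).1)⁻¹ = T.1
    have key : num s (iI n).1 = T.1 * den s (iI n).1 := by
      have hT : T.1 = cx (T.1.map Complex.re) + Complex.I • cx (T.1.map Complex.im) := by
        ext i j
        apply Complex.ext <;> simp [cx]
      have hc : cx (T.1.map Complex.im) * cx B⁻¹ = cx Bᵀ := by
        rw [← cx_mul, hY, Matrix.mul_assoc, Matrix.mul_nonsing_inv _ hB, Matrix.mul_one]
      rw [hden, num, Matrix.toBlocks_fromBlocks₂₁, Matrix.toBlocks_fromBlocks₂₂]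
      conv_rhs => rw [hT, Matrix.add_mul, Matrix.smul_mul, hc]
      rw [← zero_sub, cx_sub, cx_zero, cx_mul, iI]
      simp [add_comm]
    rw [key, Matrix.mul_assoc, Matrix.mul_nonsing_inv _ hu, Matrix.mul_one]

/-! ### The orbit maps -/

/-- The vector component of `x y⁻¹` is `ρ(y)` applied to `x.h - y.h`. -/
theorem mul_inv_mem_G₀_iff {n : ℕ} (x y : G n) : x * y⁻¹ ∈ G₀ n ↔ x.h = y.h := by
  change (x * y⁻¹).h = 0 ↔ _
  rw [G.mul_h, G.inv_h, G.inv_g, map_inv, inv_inv, neg_add_eq_zero]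
  constructor
  · intro h
    have := congrArg (fun v => (rho n y.g)⁻¹.1 *ᵥ v) h
    simpa only [G.inv_mulVec_mulVec] using this.symm
  · intro h
    rw [h]

/-- `U(n)` is the stabilizer of `iI`, and `ρ(x) ρ(y)⁻¹` fixes `iI` exactly when `ρ(x)⁻¹` and
`ρ(y)⁻¹` move it to the same point. -/
theorem mul_inv_mem_GU_iff {n : ℕ} (x y : G n) :
    x * y⁻¹ ∈ GU n ↔ spAct (rho n x.g⁻¹) (iI n) = spAct (rho n y.g⁻¹) (iI n) := by
  change (rho n (x * y⁻¹).g).1 ∈ Matrix.orthogonalGroup (Fin n ⊕ Fin n) ℝ ↔ _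
  rw [← spAct_iI_eq_iff, G.mul_g, G.inv_g, map_mul, map_inv, map_inv, spAct_mul]
  constructor
  · intro h
    have := congrArg (spAct (rho n x.g)⁻¹) h
    rw [← spAct_mul, inv_mul_cancel, spAct_one] at this
    exact this.symm
  · intro h
    rw [← h, ← spAct_mul, mul_inv_cancel, spAct_one]

theorem mu_zero_fst {n : ℕ} (x : G n) (T : Siegel n) : (mu x (0, T)).1 = x.h := by
  simp [mu]

theorem mu_zero_surjective {n : ℕ} : Function.Surjective fun x : G n => mu x (0, iI n) := by
  rintro ⟨h, T⟩
  obtain ⟨g, hg⟩ := exists_mp_spAct_iI T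
  refine ⟨⟨h, 0, g⁻¹⟩, Prod.ext (mu_zero_fst _ _) ?_⟩
  change spAct (rho n g⁻¹⁻¹) (iI n) = T
  rw [inv_inv]
  exact hg

/-- A surjection `f` on a group whose fibres are the right cosets of `s` induces a bijection
`x⁻¹ s ↦ f x`. -/
theorem exists_equiv_quotient {Γ β : Type*} [Group Γ] (s : Subgroup Γ) (f : Γ → β)
    (hf : Function.Surjective f) (h : ∀ x y, f x = f y ↔ x * y⁻¹ ∈ s) :
    ∃ Φ : Γ ⧸ s ≃ β, ∀ x, Φ (QuotientGroup.mk x⁻¹) = f x := by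
  -- A right action has right cosets as fibres, whereas `Γ ⧸ s` consists of left cosets; inversion
  -- exchanges the two.
  have hq : ∀ a b : Γ, (QuotientGroup.mk a : Γ ⧸ s) = QuotientGroup.mk b ↔ f a⁻¹ = f b⁻¹ :=
    fun a b => by rw [QuotientGroup.eq, h, inv_inv]
  let F : Γ ⧸ s → β := Quotient.lift (fun a => f a⁻¹) fun a b hab => (hq a b).1 (Quotient.sound hab)
  have hF : Function.Bijective F := by
    constructor
    · rintro ⟨a⟩ ⟨b⟩ hab
      exact (hq a b).2 hab
    · intro b
      obtain ⟨x, rfl⟩ := hf b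
      exact ⟨QuotientGroup.mk x⁻¹, congrArg f (inv_inv x)⟩
  exact ⟨Equiv.ofBijective F hF, fun x => congrArg f (inv_inv x)⟩

end Oscillator

end

/-! ### The two bijections. -/

theorem mainTheorem5 (n : ℕ) (i : Fin 2) :
    (∀ T : Oscillator.Siegel n,
      ∃ Φ : Oscillator.G n ⧸ Oscillator.G₀ n ≃
          Oscillator.IrrClass (Oscillator.imAlg i (Oscillator.sigmaT T)),
        ∀ x : Oscillator.G n,
          ∃ W : Oscillator.IrrSubrep (Oscillator.imAlg i (Oscillator.sigmaT T)),
            W.space = Oscillator.cline (Oscillator.mu x (0, T)).1 T ∧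
              Φ (QuotientGroup.mk x⁻¹) = W.cls) ∧
    (∃ Ψ : Oscillator.G n ⧸ (Oscillator.G₀ n ⊓ Oscillator.GU n) ≃
        (s : Set.range (Oscillator.sigmaT (n := n))) ×
          Oscillator.IrrClass (Oscillator.imAlg i s.1),
      ∀ x : Oscillator.G n,
        ∃ W : Oscillator.IrrSubrep (Oscillator.imAlg i
            (Oscillator.sigmaT (Oscillator.mu x (0, Oscillator.iI n)).2)),
          W.space = Oscillator.cline (Oscillator.mu x (0, Oscillator.iI n)).1
              (Oscillator.mu x (0, Oscillator.iI n)).2 ∧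
            Ψ (QuotientGroup.mk x⁻¹) =
              ⟨⟨Oscillator.sigmaT (Oscillator.mu x (0, Oscillator.iI n)).2,
                Set.mem_range_self _⟩, W.cls⟩) := by
  open Oscillator in
  constructor
  · intro T
    obtain ⟨Φ, hΦ⟩ := exists_equiv_quotient (G₀ n) (fun x : G n => (cohIrr i T x.h).cls)
      (fun c => by
        obtain ⟨h, rfl⟩ := (cohIrr_cls_bijective i T).2 c
        exact ⟨⟨h, 0, 1⟩, rfl⟩)
      (fun x y => by
        rw [mul_inv_mem_G₀_iff]
        exact (cohIrr_cls_bijective i T).1.eq_iff)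
    refine ⟨Φ, fun x => ⟨cohIrr i T x.h, ?_, hΦ x⟩⟩
    rw [mu_zero_fst]
    rfl
  · obtain ⟨Ψ, hΨ⟩ := exists_equiv_quotient (G₀ n ⊓ GU n)
      (fun x : G n => cohPair i (mu x (0, iI n)))
      ((cohPair_bijective i).2.comp mu_zero_surjective)
      (fun x y => by
        rw [(cohPair_bijective i).1.eq_iff, Subgroup.mem_inf, mul_inv_mem_G₀_iff,
          mul_inv_mem_GU_iff, Prod.ext_iff, mu_zero_fst, mu_zero_fst]
        rfl)
    exact ⟨Ψ, fun x => ⟨cohIrr i _ _, rfl, hΨ x⟩⟩
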